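/- For an even positive integer $k$ put $k^*=4k$ if $\gcd(k,6)=2$ and $k^*=36k$ if $6\mid k$. For $h$ coprime to $k$ let $h'$ denote a solution of $hh'\equiv-1\pmod{k^*}$. For $a\in\{1,2\}$ and $x,y\in\frac12\mathbb Z$ define $$K_{k,a}(x,y)=\sum_{\substack{0\le h<ak\\ \gcd(h,ak)=1\\ hh'\equiv-1\ (k^*)}}e^{\frac{2\pi i}{ak}(-xh+yh')},$$ and, for integers $N\ge k$ and $\ell$ with $N+1\le \ell\le N+k-1$, define $$\mathbb K_{k,\ell}(x,y)=\sum_{\substack{0\le h<k\\ \gcd(h,k)=1\\ hh'\equiv-1\ (k^*)\\ N<k+k_1\le \ell}}e^{\frac{2\pi i}{k}(-xh+yh')},$$ where $k_1=k_1(h,k,N)$ is the denominator of the fraction preceding $\frac hk$ in the Farey sequence of order $N$ (the increasing sequence of all reduced fractions in $[0,1]$ with denominator at most $N$). In these sums each $h$ contributes one term, which does not depend on the choice of $h'$. Theorem. For every $\varepsilon>0$ there is a constant $C=C(\varepsilon)>0$, depending only on $\varepsilon$, such that for all $N\in\mathbb N$, all even integers $k$ with $0<k\le N$, all $a,b\in\mathbb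 Z$, all odd integers $n,m$ and all integers $\ell$ with $N+1\le\ell\le N+k-1$: $$|K_{k,2}(a,b)|\le C\,k^{\frac23+\varepsilon}\gcd(|a|,k)^{\frac13},$$ $$\left|K_{k,1}\!\left(\tfrac n2,\tfrac m2\right)\right|\le C\,k^{\frac23+\varepsilon}\gcd(|n|,k)^{\frac13},$$ $$\left|\mathbb K_{k,\ell}\!\left(\tfrac n2,\tfrac m2\right)\right|\le C\,k^{\frac23+\varepsilon}\gcd(|n|,k)^{\frac13}.$$ -/

import Mathlib

/-- The modulus `k*`, for even `k`: `4k` if `gcd(k,6) = 2`, and `36k` if `6 ∣ k`. -/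
def kStar (k : ℕ) : ℕ := if Nat.gcd k 6 = 2 then 4 * k else 36 * k

/-- The pairs `(h, h')` with `0 ≤ h < M`, `gcd(h, M) = 1` and `h h' ≡ -1 (mod k*)`, where the
solution `h'` of the congruence is taken to be its representative with `0 ≤ h' < k*`. -/
def kloostermanPairs (k M : ℕ) : Finset (ℕ × ℕ) :=
  (Finset.range M ×ˢ Finset.range (kStar k)).filter
    (fun p => Nat.gcd p.1 M = 1 ∧ (p.1 : ℤ) * (p.2 : ℤ) ≡ -1 [ZMOD (kStar k : ℤ)])

/-- The Farey fractions of order `N`: all `h/k` with `0 ≤ h ≤ k ≤ N`, `1 ≤ k`, `gcd(h,k) = 1`. -/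
def farey (N : ℕ) : Finset ℚ :=
  ((Finset.range (N + 1) ×ˢ Finset.range (N + 1)).filter
    (fun p => 1 ≤ p.2 ∧ p.1 ≤ p.2 ∧ Nat.gcd p.1 p.2 = 1)).image
    (fun p => (p.1 : ℚ) / (p.2 : ℚ))

/-- The fraction preceding `x` in the Farey sequence of order `N`, that is, the largest Farey
fraction of order `N` below `x` (and `0` if there is none, which does not happen for `x > 0`). -/
def fareyPred (N : ℕ) (x : ℚ) : ℚ := ((farey N).filter (fun q => q < x)).max.unbotD 0

/-- `k₁`: the denominator of the fraction preceding `h/k` in the Farey sequence of order `N`. -/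
def fareyPredDen (N h k : ℕ) : ℕ := (fareyPred N ((h : ℚ) / (k : ℚ))).den

/-- `K_{k,a}(x,y)`, the sum of `exp ((2πi/(ak)) (-x h + y h'))` over `0 ≤ h < ak` with
`gcd(h, ak) = 1` and `h h' ≡ -1 (mod k*)`. -/
noncomputable def kloostermanK (k a : ℕ) (x y : ℚ) : ℂ :=
  ∑ p ∈ kloostermanPairs k (a * k),
    Complex.exp (2 * (Real.pi : ℂ) * Complex.I / ((a : ℂ) * (k : ℂ)) *
      (-(x : ℂ) * (p.1 : ℂ) + (y : ℂ) * (p.2 : ℂ)))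

/-- The incomplete sum `𝕂_{k,ℓ}(x,y)` with respect to the Farey sequence of order `N`: the sum of
`exp ((2πi/k) (-x h + y h'))` over `0 ≤ h < k` with `gcd(h, k) = 1`, `h h' ≡ -1 (mod k*)` and
`N < k + k₁ ≤ ℓ`. -/
noncomputable def incompleteK (N k l : ℕ) (x y : ℚ) : ℂ :=
  ∑ p ∈ (kloostermanPairs k k).filter
      (fun p => N < k + fareyPredDen N p.1 k ∧ k + fareyPredDen N p.1 k ≤ l),
    Complex.exp (2 * (Real.pi : ℂ) * Complex.I / (k : ℂ) *
      (-(x : ℂ) * (p.1 : ℂ) + (y : ℂ) * (p.2 : ℂ)))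

/-- For even `k`, each `h` coprime to `k` has exactly one admissible `h'` in `[0, k*)`. -/
theorem existsUnique_kStar_inverse {k h : ℕ} (hk : 0 < k) (he : Even k) (hc : Nat.gcd h k = 1) :
    ∃! h' : ℕ, h' < kStar k ∧ (h : ℤ) * (h' : ℤ) ≡ -1 [ZMOD (kStar k : ℤ)] := by
  have hcop : Nat.Coprime h (kStar k) := by
    have h2 : Nat.Coprime h 2 := Nat.Coprime.coprime_dvd_right he.two_dvd hc
    unfold kStar
    split_ifs with hg
    · exact Nat.Coprime.mul_right (Nat.Coprime.pow_right 2 h2) hc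
    · have h6 : 6 ∣ k := by
        obtain ⟨r, rfl⟩ := he
        have h3 : 3 ∣ r := by
          by_contra h3
          apply hg
          have : Nat.gcd 3 r = 1 := (Nat.Prime.coprime_iff_not_dvd Nat.prime_three).2 h3
          have e : Nat.gcd (2 * r) (2 * 3) = 2 * Nat.gcd r 3 := Nat.gcd_mul_left 2 r 3
          rw [Nat.gcd_comm r 3, this] at e
          simpa [two_mul] using e
        omega
      have h6' : Nat.Coprime h 6 := Nat.Coprime.coprime_dvd_right h6 hc
      exact Nat.Coprime.mul_right (Nat.Coprime.pow_right 2 h6') hc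
  have hpos : 0 < kStar k := by unfold kStar; split_ifs <;> omega
  have : NeZero (kStar k) := ⟨hpos.ne'⟩
  set u := ZMod.unitOfCoprime h hcop with hu
  have hu' : (u : ZMod (kStar k)) = (h : ZMod (kStar k)) := ZMod.coe_unitOfCoprime h hcop
  refine ⟨(-(↑u⁻¹ : ZMod (kStar k))).val, ⟨ZMod.val_lt _, ?_⟩, ?_⟩
  · rw [← ZMod.intCast_eq_intCast_iff]
    push_cast
    rw [ZMod.natCast_zmod_val, ← hu']
    simp
  · rintro y ⟨hy, hy'⟩
    rw [← ZMod.intCast_eq_intCast_iff] at hy'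
    push_cast at hy'
    rw [← hu'] at hy'
    have : (y : ZMod (kStar k)) = -(↑u⁻¹ : ZMod (kStar k)) := by
      calc (y : ZMod (kStar k)) = ↑u⁻¹ * (↑u * y) := by simp
        _ = _ := by rw [hy']; simp
    rw [← this, ZMod.val_natCast, Nat.mod_eq_of_lt hy]

/-- For `0 < h < k ≤ N` the fraction preceding `h/k` exists and is its left neighbour. -/
theorem fareyPred_spec {N h k : ℕ} (hh : 0 < h) (hk : 0 < k) (hN : k ≤ N) :
    fareyPred N ((h : ℚ) / k) ∈ farey N ∧ fareyPred N ((h : ℚ) / k) < (h : ℚ) / k ∧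
      ∀ q ∈ farey N, q < (h : ℚ) / k → q ≤ fareyPred N ((h : ℚ) / k) := by
  have h0 : (0 : ℚ) ∈ (farey N).filter (fun q => q < (h : ℚ) / k) := by
    rw [Finset.mem_filter]
    refine ⟨Finset.mem_image.2 ⟨(0, 1), ?_, by simp⟩, by positivity⟩
    simp
    omega
  obtain ⟨m, hm⟩ := Finset.max_of_mem h0
  have e : fareyPred N ((h : ℚ) / k) = m := by unfold fareyPred; rw [hm]; rfl
  have hmem := Finset.mem_filter.1 (Finset.mem_of_max hm)
  rw [e]
  exact ⟨hmem.1, hmem.2, fun q hq hlt => Finset.le_max_of_eq (Finset.mem_filter.2 ⟨hq, hlt⟩) hm⟩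

/-! Each of the three sums reduces to the classical Kloosterman sum `kloostermanSum`, with `ψ` the
standard additive character modulo `c = 2k`; for that sum the bound `c^(2/3+ε) gcd(a,c)^(1/3)` is
proved by an elementary moment argument, without Weil's theorem.

Over a field with `q` elements, the cube of the sum is the double Fourier transform of the number of
triples of units with prescribed sum `s` and prescribed sum of inverses `t`. Apart from the mean
value `q`, this count is a quadratic character sum of a cubic depending on `(s, t)`, and it is small
in mean square over `(s, t)` by orthogonality (`sum_sq_invTripleCount_sub_card_le`). Parseval then
bounds the sixth moment over all `(a, b)`. Since the sum is constant on the `q - 1` points `(a c, b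
c⁻¹)`, a single value satisfies `|K|³ ≤ 12 q²` (`norm_kloostermanSum_pow_three_le`).

Modulo `p^j` with `j ≥ 2`, stationary phase leaves few terms
(`norm_kloostermanSum_le_card_of_sq_eq_zero`, `card_stationary_points_le`). Twisted multiplicativity
gives general moduli, with a loss of `64` per prime factor, absorbed in `c^ε`.

For the sums of the theorem, `k*` is a multiple of `2k`, so `K_{k,2}` is a complete sum modulo `2k`,
and `K_{k,1}` at odd half-integers is half of one. The Farey condition on `k₁` confines `h'` to an
interval modulo `k` (`fareyPredDen_le_iff`). Expanding its indicator in characters modulo `k` shifts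
`m` by even integers and costs a factor `2 + log k`. -/

/-! ### Counting triples over a finite field in mean square -/

section FiniteField

open Finset

variable {F : Type*} [Field F] [Fintype F] [DecidableEq F]

/-- The number of pairs of nonzero elements with sum `S` whose inverses have sum `T`. -/
def invPairCount (S T : F) : ℕ :=
  #{v : Fˣ × Fˣ | (v.1 : F) + v.2 = S ∧ (v.1 : F)⁻¹ + (v.2 : F)⁻¹ = T}

/-- The number of triples of nonzero elements with sum `s` whose inverses have sum `t`. -/
def invTripleCount (s t : F) : ℕ :=
  #{v : Fˣ × Fˣ × Fˣ | (v.1 : F) + (v.2.1 + v.2.2) = s ∧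
    (v.1 : F)⁻¹ + ((v.2.1 : F)⁻¹ + (v.2.2 : F)⁻¹) = t}

/-- The character sum attached to the cubic `w (-4 w² + A w + B)`. -/
def cubicCharSum (A B : F) : ℤ := ∑ w : F, quadraticChar F (w * (-4 * w ^ 2 + A * w + B))

theorem invTripleCount_eq_sum (s t : F) :
    invTripleCount s t = ∑ z : Fˣ, invPairCount (s - z) (t - (z : F)⁻¹) := by
  unfold invTripleCount invPairCount
  simp only [card_filter]
  rw [Fintype.sum_prod_type]
  refine sum_congr rfl fun z _ => sum_congr rfl fun v _ => ?_
  simp only [eq_sub_iff_add_eq']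

theorem quadraticChar_mul_sq (a : F) {c : F} (hc : c ≠ 0) :
    quadraticChar F (a * c ^ 2) = quadraticChar F a := by
  rw [map_mul, quadraticChar_sq_one' hc, mul_one]

/-- The relation `S = T x y` fixes the product as `S / T`, so `x, y` are the roots of `X² - S X + S
/ T`. Ordered pairs correspond to the square roots `d = x - y` of its discriminant, which equals `S
T (S T - 4)` up to the square `T²`. -/
theorem invPairCount_of_ne_zero (h2 : ringChar F ≠ 2) {S T : F} (hS : S ≠ 0) (hT : T ≠ 0) :
    (invPairCount S T : ℤ) = quadraticChar F (S * T * (S * T - 4)) + 1 := by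
  have two : (2 : F) ≠ 0 := Ring.two_ne_zero h2
  have e : S * T * (S * T - 4) = (S ^ 2 - 4 * (S / T)) * T ^ 2 := by field_simp
  rw [e, quadraticChar_mul_sq _ hT, ← quadraticChar_card_sqrts h2]
  norm_cast
  unfold invPairCount
  have key : ∀ d : F, d ^ 2 = S ^ 2 - 4 * (S / T) → (S + d) / 2 * ((S - d) / 2) = S / T := by
    intro d hd
    have : (4 : F) ≠ 0 := by
      have : (4 : F) = 2 * 2 := by norm_num
      rw [this]; exact mul_ne_zero two two
    have h : (S + d) / 2 * ((S - d) / 2) = (S ^ 2 - d ^ 2) / 4 := by field_simp; ring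
    rw [h, hd]; field_simp; ring
  have hST : S / T ≠ 0 := div_ne_zero hS hT
  refine card_bij (fun v _ => (v.1 : F) - v.2) ?_ ?_ ?_
  · rintro ⟨x, y⟩ h
    simp only [mem_filter, mem_univ, true_and] at h
    simp only [Set.toFinset_ofPred, mem_filter, mem_univ, true_and]
    obtain ⟨h1, h3⟩ := h
    have hx := x.ne_zero
    have hy := y.ne_zero
    have h4 : S = T * (x * y) := by
      rw [← h1, ← h3]; field_simp; ring
    have : S / T = x * y := by rw [div_eq_iff hT, h4]; ring
    rw [this, ← h1]; ring
  · rintro ⟨x, y⟩ h ⟨x', y'⟩ h' heq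
    simp only [mem_filter, mem_univ, true_and] at h h' heq
    have a1 : (2 : F) * x = 2 * x' := by linear_combination h.1 - h'.1 + heq
    have a2 : (2 : F) * y = 2 * y' := by linear_combination h.1 - h'.1 - heq
    have b1 := mul_left_cancel₀ two a1
    have b2 := mul_left_cancel₀ two a2
    simp [Units.ext_iff, b1, b2]
  · intro d hd
    simp only [Set.toFinset_ofPred, mem_filter, mem_univ, true_and] at hd
    have hk := key d hd
    have hx : (S + d) / 2 ≠ 0 := fun h => hST (by rw [← hk, h, zero_mul])
    have hy : (S - d) / 2 ≠ 0 := fun h => hST (by rw [← hk, h, mul_zero])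
    refine ⟨(Units.mk0 _ hx, Units.mk0 _ hy), ?_, ?_⟩
    · simp only [mem_filter, mem_univ, true_and, Units.val_mk0]
      have hs : (S + d) / 2 + (S - d) / 2 = S := by field_simp; ring
      refine ⟨hs, ?_⟩
      rw [inv_add_inv hx hy, hs, hk]; field_simp
    · simp only [Units.val_mk0]; field_simp; ring

theorem invPairCount_eq_zero {S T : F} (h : ¬(S = 0 ∧ T = 0)) (h' : S = 0 ∨ T = 0) :
    invPairCount S T = 0 := by
  unfold invPairCount
  rw [card_eq_zero, filter_eq_empty_iff]
  rintro ⟨x, y⟩ - ⟨h1, h2⟩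
  have hx := x.ne_zero
  have hy := y.ne_zero
  simp only at h1 h2
  have h3 : T * (x * y) = S := by rw [← h1, ← h2]; field_simp; ring
  refine h ?_
  rcases h' with rfl | rfl
  · exact ⟨rfl, by simpa [hx, hy] using h3⟩
  · exact ⟨by simpa using h3.symm, rfl⟩

theorem invPairCount_le (h2 : ringChar F ≠ 2) (S T : F) :
    invPairCount S T ≤ 2 + if S = 0 ∧ T = 0 then Fintype.card F else 0 := by
  split_ifs with h
  · unfold invPairCount
    refine le_trans ?_ (Nat.le_add_left _ _)
    rw [← Finset.card_univ]
    refine card_le_card_of_injOn (fun v => (v.1 : F)) (fun _ _ => mem_coe.2 (mem_univ _)) ?_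
    rintro ⟨x, y⟩ hv ⟨x', y'⟩ hv' heq
    simp only [coe_filter, mem_univ, true_and, Set.mem_ofPred_eq] at hv hv' heq
    have : (y : F) = y' := by linear_combination hv.1 - hv'.1 - heq
    simp [Units.ext_iff, heq, this]
  · by_cases h' : S = 0 ∨ T = 0
    · rw [invPairCount_eq_zero h h']; omega
    · push Not at h'
      have := invPairCount_of_ne_zero h2 h'.1 h'.2
      rcases quadraticChar_isQuadratic F (S * T * (S * T - 4)) with e | e | e <;> omega

theorem invTripleCount_le (h2 : ringChar F ≠ 2) (s t : F) :
    invTripleCount s t ≤ 3 * Fintype.card F := by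
  rw [invTripleCount_eq_sum]
  calc ∑ z : Fˣ, invPairCount (s - z) (t - (z : F)⁻¹)
      ≤ ∑ z : Fˣ, (2 + if (z : F) = s then Fintype.card F else 0) := by
        refine sum_le_sum fun z _ => (invPairCount_le h2 _ _).trans ?_
        gcongr
        split_ifs with h h' h'
        · rfl
        · exact absurd (sub_eq_zero.1 h.1).symm h'
        · exact Nat.zero_le _
        · rfl
    _ ≤ 2 * Fintype.card F + Fintype.card F := by
        rw [sum_add_distrib]
        have hc : Fintype.card Fˣ ≤ Fintype.card F :=
          Fintype.card_le_of_injective _ Units.val_injective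
        gcongr
        · simp only [sum_const, card_univ, smul_eq_mul]; linarith
        · rw [← sum_filter, sum_const, smul_eq_mul]
          have : #{z : Fˣ | (z : F) = s} ≤ 1 := by
            refine card_le_one.2 fun x hx y hy => ?_
            simp only [mem_filter, mem_univ, true_and] at hx hy
            exact Units.ext (hx.trans hy.symm)
          nlinarith
    _ = _ := by ring

theorem quadraticChar_eq_one_of_eq_sq {a c : F} (hc : c ≠ 0) (h : a = c ^ 2) :
    quadraticChar F a = 1 := by
  rw [h, quadraticChar_sq_one' hc]

/-- The Möbius substitution `w = s² (t z - 1) / (s - z)` turns the argument into `s` times the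
cubic, up to a square factor. The point `z = s`, sent to infinity, contributes zero. The values `w =
-s` and `w = -s (s t)` come from `z = 0` and `z = ∞`; there `s` times the cubic is a nonzero square,
which accounts for the `-2`. -/
theorem sum_units_quadraticChar_eq {s t : F} (hs : s ≠ 0) (ht : t ≠ 0) (h1 : s * t ≠ 1) :
    ∑ z : Fˣ, quadraticChar F ((s - z) * (t - (z : F)⁻¹) * ((s - z) * (t - (z : F)⁻¹) - 4)) =
      quadraticChar F s *
        cubicCharSum (s * ((s * t) ^ 2 - 6 * (s * t) - 3)) (-4 * s ^ 2 * (s * t)) - 2 := by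
  have hst : s * t - 1 ≠ 0 := sub_ne_zero.2 h1
  set A := s * ((s * t) ^ 2 - 6 * (s * t) - 3) with hA
  set B := -4 * s ^ 2 * (s * t) with hB
  set g : F → ℤ := fun w => quadraticChar F (s * (w * (-4 * w ^ 2 + A * w + B))) with hg
  have e1 : quadraticChar F s * cubicCharSum A B = ∑ w, g w := by
    simp only [cubicCharSum, mul_sum, hg, ← map_mul]
  have hne : -(s * (s * t)) ≠ -s := by
    intro h
    refine hst (mul_left_cancel₀ hs ?_)
    linear_combination -h
  have ga : g (-(s * (s * t))) = 1 :=
    quadraticChar_eq_one_of_eq_sq (c := s ^ 2 * (s * t) * (s * t - 1))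
      (by simp [hs, ht, hst]) (by rw [hA, hB]; ring)
  have gb : g (-s) = 1 :=
    quadraticChar_eq_one_of_eq_sq (c := s ^ 2 * (s * t - 1))
      (by simp [hs, hst]) (by rw [hA, hB]; ring)
  have e2 : ∑ w, g w =
      ∑ w with w ≠ -(s * (s * t)) ∧ w ≠ -s, g w + 2 := by
    rw [← sum_filter_add_sum_filter_not univ (fun w => w ≠ -(s * (s * t)) ∧ w ≠ -s)]
    congr 1
    have : univ.filter (fun w => ¬(w ≠ -(s * (s * t)) ∧ w ≠ -s)) =
        {-(s * (s * t)), -s} := by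
      ext w
      simp only [mem_filter, mem_univ, true_and, mem_insert, mem_singleton]
      tauto
    rw [this, sum_pair hne, ga, gb]; norm_num
  rw [e1, e2, add_sub_cancel_right]
  have e3 : ∑ z : Fˣ,
      quadraticChar F ((s - z) * (t - (z : F)⁻¹) * ((s - z) * (t - (z : F)⁻¹) - 4)) =
      ∑ z ∈ univ.filter (fun z : Fˣ => (z : F) ≠ s),
        quadraticChar F ((s - z) * (t - (z : F)⁻¹) * ((s - z) * (t - (z : F)⁻¹) - 4)) := by
    symm
    refine sum_filter_of_ne ?_
    intro z _ h hz
    exact h (by rw [hz]; simp)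
  rw [e3]
  refine sum_bij (fun z _ => s ^ 2 * (t * z - 1) / (s - z)) ?_ ?_ ?_ ?_
  · intro z hz
    simp only [mem_filter, mem_univ, true_and] at hz ⊢
    have hz' : s - (z : F) ≠ 0 := sub_ne_zero.2 (Ne.symm hz)
    have hz0 := z.ne_zero
    constructor
    · intro h
      rw [div_eq_iff hz'] at h
      exact mul_ne_zero (pow_ne_zero 2 hs) hst (by linear_combination h)
    · intro h
      rw [div_eq_iff hz'] at h
      refine mul_ne_zero (mul_ne_zero hs hz0) hst (by linear_combination h)
  · intro z hz z' hz' h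
    simp only [mem_filter, mem_univ, true_and] at hz hz'
    have b1 : s - (z : F) ≠ 0 := sub_ne_zero.2 (Ne.symm hz)
    have b2 : s - (z' : F) ≠ 0 := sub_ne_zero.2 (Ne.symm hz')
    rw [div_eq_div_iff b1 b2] at h
    refine Units.ext (mul_left_cancel₀ (mul_ne_zero (pow_ne_zero 2 hs) hst) ?_)
    linear_combination h
  · intro w hw
    simp only [mem_filter, mem_univ, true_and] at hw
    have b1 : w + s * (s * t) ≠ 0 := fun h => hw.1 (eq_neg_of_add_eq_zero_left h)
    have b1' : w + s ^ 2 * t ≠ 0 := by convert b1 using 2; ring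
    have b2 : w + s ≠ 0 := fun h => hw.2 (eq_neg_of_add_eq_zero_left h)
    have hz : s * (w + s) / (w + s * (s * t)) ≠ 0 := div_ne_zero (mul_ne_zero hs b2) b1
    have hsz : s - s * (w + s) / (w + s * (s * t)) =
        s ^ 2 * (s * t - 1) / (w + s * (s * t)) := by
      field_simp; ring
    refine ⟨Units.mk0 _ hz, ?_, ?_⟩
    · simp only [mem_filter, mem_univ, true_and, Units.val_mk0]
      intro h
      rw [h, sub_self] at hsz
      exact div_ne_zero (mul_ne_zero (pow_ne_zero 2 hs) hst) b1 hsz.symm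
    · simp only [Units.val_mk0]
      rw [hsz, div_eq_iff (div_ne_zero (mul_ne_zero (pow_ne_zero 2 hs) hst) b1)]
      field_simp
      ring
  · intro z hz
    simp only [mem_filter, mem_univ, true_and] at hz
    have b1 : s - (z : F) ≠ 0 := sub_ne_zero.2 (Ne.symm hz)
    have hz0 := z.ne_zero
    simp only [hg]
    rw [← quadraticChar_mul_sq _ (c := s ^ 3 * z * (s * t - 1) / (s - z) ^ 2)
      (div_ne_zero (mul_ne_zero (mul_ne_zero (pow_ne_zero 3 hs) hz0) hst) (pow_ne_zero 2 b1))]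
    congr 1
    rw [hA, hB]
    field_simp
    ring

/-- At `z = s` and `z = t⁻¹` the pair count is `0`, whereas the character formula would give `1`;
the hypothesis `s t ≠ 1` keeps these points distinct and excludes `S = T = 0`. The constants are
thus `q - 1` units, minus `2` exceptional ones, minus the `2` of the substitution. -/
theorem invTripleCount_sub_card (h2 : ringChar F ≠ 2) {s t : F} (hs : s ≠ 0) (ht : t ≠ 0)
    (h1 : s * t ≠ 1) :
    (invTripleCount s t : ℤ) - Fintype.card F =
      quadraticChar F s *
        cubicCharSum (s * ((s * t) ^ 2 - 6 * (s * t) - 3)) (-4 * s ^ 2 * (s * t)) - 5 := by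
  have hterm : ∀ z : Fˣ, (invPairCount (s - z) (t - (z : F)⁻¹) : ℤ) =
      quadraticChar F ((s - z) * (t - (z : F)⁻¹) * ((s - z) * (t - (z : F)⁻¹) - 4)) +
        (1 - if (z : F) = s ∨ (z : F) = t⁻¹ then 1 else 0) := by
    intro z
    have iff1 : s - (z : F) = 0 ↔ (z : F) = s := by rw [sub_eq_zero, eq_comm]
    have iff2 : t - (z : F)⁻¹ = 0 ↔ (z : F) = t⁻¹ := by
      rw [sub_eq_zero, eq_comm, inv_eq_iff_eq_inv]
    split_ifs with h
    · have h' : s - (z : F) = 0 ∨ t - (z : F)⁻¹ = 0 := by rwa [iff1, iff2]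
      rw [invPairCount_eq_zero _ h']
      · rcases h' with h' | h' <;> simp [h']
      · rw [iff1, iff2]
        rintro ⟨e, e'⟩
        exact h1 (by rw [← e, e', inv_mul_cancel₀ ht])
    · push Not at h
      rw [invPairCount_of_ne_zero h2 (fun e => h.1 (iff1.1 e)) (fun e => h.2 (iff2.1 e))]
      ring
  have hcard : #{z : Fˣ | (z : F) = s ∨ (z : F) = t⁻¹} = 2 := by
    have : ({z : Fˣ | (z : F) = s ∨ (z : F) = t⁻¹} : Finset Fˣ) =
        {Units.mk0 s hs, (Units.mk0 t ht)⁻¹} := by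
      ext z
      simp [Units.ext_iff]
    rw [this, card_pair]
    intro h
    have h' : s = t⁻¹ := by simpa [Units.ext_iff] using h
    exact h1 (by rw [h', inv_mul_cancel₀ ht])
  have hunits : (Fintype.card Fˣ : ℤ) = Fintype.card F - 1 := by
    rw [Fintype.card_units, Nat.cast_sub Fintype.card_pos, Nat.cast_one]
  rw [invTripleCount_eq_sum, Nat.cast_sum, sum_congr rfl fun z _ => hterm z, sum_add_distrib,
    sum_units_quadraticChar_eq hs ht h1, sum_sub_distrib, sum_const, card_univ, nsmul_eq_mul,
    mul_one, ← sum_filter, sum_const, hcard, hunits]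
  ring

/-- For `v ≠ w` the two arguments are independent linear forms in `(A, B)` up to constants, so the
sum factors into two complete character sums. -/
theorem sum_quadraticChar_mul_eq_zero (h2 : ringChar F ≠ 2) {v w : F} (h : v ≠ w) :
    ∑ A : F, ∑ B : F, quadraticChar F (-4 * v ^ 2 + A * v + B) *
      quadraticChar F (-4 * w ^ 2 + A * w + B) = 0 := by
  have hvw : v - w ≠ 0 := sub_ne_zero.2 h
  have : ∑ p : F × F, quadraticChar F (-4 * v ^ 2 + p.1 * v + p.2) *
      quadraticChar F (-4 * w ^ 2 + p.1 * w + p.2) =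
      ∑ p : F × F, quadraticChar F p.1 * quadraticChar F p.2 := by
    refine Fintype.sum_bijective
      (fun p : F × F => (-4 * v ^ 2 + p.1 * v + p.2, -4 * w ^ 2 + p.1 * w + p.2)) ?_ _ _
      fun _ => rfl
    rw [← Finite.injective_iff_bijective]
    rintro ⟨a, b⟩ ⟨a', b'⟩ heq
    simp only [Prod.mk.injEq] at heq
    obtain ⟨e1, e2⟩ := heq
    have ha : a = a' := mul_right_cancel₀ hvw (by linear_combination e1 - e2)
    subst ha
    exact Prod.ext rfl (by linear_combination e1)
  rw [← Fintype.sum_prod_type', this, Fintype.sum_prod_type]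
  simp only [← mul_sum, quadraticChar_sum_zero h2, mul_zero, sum_const_zero]

theorem sum_sq_cubicCharSum_le (h2 : ringChar F ≠ 2) :
    ∑ p : F × F, cubicCharSum p.1 p.2 ^ 2 ≤ (Fintype.card F : ℤ) ^ 3 := by
  have expand : ∀ A B : F, cubicCharSum A B ^ 2 = ∑ v : F, ∑ w : F,
      quadraticChar F v * quadraticChar F w * (quadraticChar F (-4 * v ^ 2 + A * v + B) *
      quadraticChar F (-4 * w ^ 2 + A * w + B)) := by
    intro A B
    rw [cubicCharSum, sq, sum_mul_sum]
    refine sum_congr rfl fun v _ => sum_congr rfl fun w _ => ?_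
    rw [map_mul, map_mul]; ring
  have hle : ∀ a : F, quadraticChar F a * quadraticChar F a ≤ 1 := by
    intro a
    rcases quadraticChar_isQuadratic F a with e | e | e <;> rw [e] <;> norm_num
  have hnn : ∀ a : F, 0 ≤ quadraticChar F a * quadraticChar F a := fun a => mul_self_nonneg _
  have swap : ∑ p : F × F, cubicCharSum p.1 p.2 ^ 2 = ∑ v : F, ∑ w : F,
      quadraticChar F v * quadraticChar F w * ∑ A : F, ∑ B : F,
      (quadraticChar F (-4 * v ^ 2 + A * v + B) * quadraticChar F (-4 * w ^ 2 + A * w + B)) := by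
    simp only [expand, mul_sum]
    rw [Fintype.sum_prod_type, sum_congr rfl fun A _ => sum_comm, sum_comm]
    refine sum_congr rfl fun v _ => ?_
    rw [sum_congr rfl fun A _ => sum_comm, sum_comm]
  rw [swap]
  calc _ = ∑ v : F, quadraticChar F v * quadraticChar F v * ∑ A : F, ∑ B : F,
      (quadraticChar F (-4 * v ^ 2 + A * v + B) * quadraticChar F (-4 * v ^ 2 + A * v + B)) := by
        refine sum_congr rfl fun v _ => sum_eq_single v (fun w _ hw => ?_) (by simp)
        rw [sum_quadraticChar_mul_eq_zero h2 hw.symm, mul_zero]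
    _ ≤ ∑ v : F, ∑ A : F, ∑ B : F, (1 : ℤ) := by
        refine sum_le_sum fun v _ => ?_
        refine (mul_le_mul (hle v) (sum_le_sum fun A _ => sum_le_sum fun B _ => hle _)
          (sum_nonneg fun A _ => sum_nonneg fun B _ => hnn _) zero_le_one).trans_eq (one_mul _)
    _ = _ := by simp; ring

/-- Since `B = -4 s³ t`, the value of `s` determines `t`, and eliminating `s t = -B / (4 s²)` from
`A` gives a quartic equation for `s`. Its constant term `B²` keeps it nonzero even in characteristic
`3`, where the leading coefficient vanishes. -/
theorem card_filter_cubic_parameters_le (h2 : ringChar F ≠ 2) (P : F × F) :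
    #{p : F × F | (p.1 ≠ 0 ∧ p.2 ≠ 0) ∧ (p.1 * ((p.1 * p.2) ^ 2 - 6 * (p.1 * p.2) - 3),
      -4 * p.1 ^ 2 * (p.1 * p.2)) = P} ≤ 4 := by
  obtain ⟨A, B⟩ := P
  have two : (2 : F) ≠ 0 := Ring.two_ne_zero h2
  have four : (4 : F) ≠ 0 := by
    have : (4 : F) = 2 * 2 := by norm_num
    rw [this]; exact mul_ne_zero two two
  by_cases hB : B = 0
  · refine le_trans (card_eq_zero.2 (filter_eq_empty_iff.2 ?_)).le (Nat.zero_le _)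
    rintro ⟨s, t⟩ - ⟨⟨hs, ht⟩, h⟩
    rw [Prod.mk.injEq] at h
    simp only at hs ht h
    rw [hB] at h
    have : (4 : F) * s ^ 3 * t = 0 := by linear_combination -h.2
    simp [hs, ht, four] at this
  let Q : Polynomial F := Polynomial.C (-48) * Polynomial.X ^ 4 + Polynomial.C (-16 * A) *
    Polynomial.X ^ 3 + Polynomial.C (24 * B) * Polynomial.X ^ 2 + Polynomial.C (B ^ 2)
  have hQ0 : Q ≠ 0 := by
    intro h
    have := congrArg (Polynomial.eval 0) h
    simp [Q, hB] at this
  have hdeg : Q.natDegree ≤ 4 := by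
    simp only [Q]; compute_degree
  refine le_trans ?_ ((Multiset.toFinset_card_le _).trans ((Polynomial.card_roots' Q).trans hdeg))
  refine card_le_card_of_injOn Prod.fst ?_ ?_
  · rintro ⟨s, t⟩ h
    simp only [coe_filter, mem_univ, true_and, Set.mem_ofPred_eq, Prod.mk.injEq] at h
    simp only [Multiset.mem_toFinset, mem_coe, Polynomial.mem_roots hQ0,
      Polynomial.IsRoot.def]
    obtain ⟨⟨hs, ht⟩, rfl, rfl⟩ := h
    simp only [Q, Polynomial.eval_add, Polynomial.eval_mul, Polynomial.eval_C,
      Polynomial.eval_pow, Polynomial.eval_X]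
    ring
  · rintro ⟨s, t⟩ h ⟨s', t'⟩ h' heq
    simp only [coe_filter, mem_univ, true_and, Set.mem_ofPred_eq, Prod.mk.injEq] at h h' heq
    subst heq
    have : -4 * s ^ 3 * t = -4 * s ^ 3 * t' := by linear_combination h.2.2 - h'.2.2
    rw [mul_left_cancel₀ (mul_ne_zero (neg_ne_zero.2 four) (pow_ne_zero 3 h.1.1)) this]

theorem sum_sq_invTripleCount_sub_card_le (h2 : ringChar F ≠ 2) :
    ∑ p : F × F, ((invTripleCount p.1 p.2 : ℤ) - Fintype.card F) ^ 2 ≤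
      70 * (Fintype.card F : ℤ) ^ 3 := by
  set q : ℤ := (Fintype.card F : ℤ) with hq
  have hq1 : (1 : ℤ) ≤ q := by
    rw [hq]; exact_mod_cast Fintype.card_pos
  let φ : F × F → F × F := fun p =>
    (p.1 * ((p.1 * p.2) ^ 2 - 6 * (p.1 * p.2) - 3), -4 * p.1 ^ 2 * (p.1 * p.2))
  have hsum : ∑ p ∈ univ.filter (fun p : F × F => p.1 ≠ 0 ∧ p.2 ≠ 0),
      cubicCharSum (φ p).1 (φ p).2 ^ 2 ≤ 4 * q ^ 3 := by
    rw [← sum_fiberwise _ φ]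
    calc _ ≤ ∑ P : F × F, 4 * cubicCharSum P.1 P.2 ^ 2 := by
          refine sum_le_sum fun P _ => ?_
          have hc : ∀ p ∈ (univ.filter (fun p : F × F => p.1 ≠ 0 ∧ p.2 ≠ 0)).filter
              (fun p => φ p = P), cubicCharSum (φ p).1 (φ p).2 ^ 2 =
                cubicCharSum P.1 P.2 ^ 2 := by
            intro p hp
            rw [(mem_filter.1 hp).2]
          rw [sum_congr rfl hc, sum_const, filter_filter, nsmul_eq_mul]
          refine mul_le_mul_of_nonneg_right ?_ (sq_nonneg _)
          exact (Int.ofNat_le.2 (card_filter_cubic_parameters_le h2 P)).trans_eq (by norm_num)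
      _ ≤ _ := by
          rw [← mul_sum]
          have := sum_sq_cubicCharSum_le (F := F) h2
          linarith
  -- Generic points use `(x - 5)² ≤ 2 x² + 50`. The at most `3 q` points with `s = 0`, `t = 0` or `s
  -- t = 1` use the trivial bound `4 q²`. In total `8 q³ + 50 q² + 12 q³ ≤ 70 q³`.
  have hpt : ∀ p : F × F, ((invTripleCount p.1 p.2 : ℤ) - q) ^ 2 ≤
      (if p.1 ≠ 0 ∧ p.2 ≠ 0 then 2 * cubicCharSum (φ p).1 (φ p).2 ^ 2 else 0) + 50 +
        4 * q ^ 2 * ((if p.1 = 0 then 1 else 0) + (if p.2 = 0 then 1 else 0) +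
          (if p.1 * p.2 = 1 then 1 else 0)) := by
    rintro ⟨s, t⟩
    have hnn : 0 ≤ cubicCharSum (φ (s, t)).1 (φ (s, t)).2 ^ 2 := sq_nonneg _
    have htriv : ((invTripleCount s t : ℤ) - q) ^ 2 ≤ 4 * q ^ 2 := by
      have h0 : (0 : ℤ) ≤ invTripleCount s t := Nat.cast_nonneg _
      have h3 : (invTripleCount s t : ℤ) ≤ 3 * q := by
        rw [hq]; exact_mod_cast invTripleCount_le h2 s t
      nlinarith
    by_cases hs : s = 0
    · simp only [hs, ne_eq, not_true_eq_false, false_and, if_false, if_true] at htriv ⊢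
      split_ifs <;> nlinarith [sq_nonneg q]
    by_cases ht : t = 0
    · simp only [ht, ne_eq, not_true_eq_false, and_false, if_false, if_true] at htriv ⊢
      split_ifs <;> nlinarith [sq_nonneg q]
    by_cases h1 : s * t = 1
    · simp only [hs, ht, h1, ne_eq, not_false_eq_true, and_self, if_false, if_true] at hnn ⊢
      linarith
    · simp only [hs, ht, h1, ne_eq, not_false_eq_true, and_self, if_false, if_true]
      rw [hq, invTripleCount_sub_card h2 hs ht h1]
      set a := cubicCharSum (s * ((s * t) ^ 2 - 6 * (s * t) - 3)) (-4 * s ^ 2 * (s * t))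
      have hsq : quadraticChar F s ^ 2 = 1 := quadraticChar_sq_one hs
      show _ ≤ 2 * a ^ 2 + 50 + _
      have : (quadraticChar F s * a) ^ 2 = a ^ 2 := by rw [mul_pow, hsq, one_mul]
      nlinarith [sq_nonneg (quadraticChar F s * a + 5)]
  refine (sum_le_sum fun p _ => hpt p).trans ?_
  have c1 : ∑ p : F × F, (if p.1 = 0 then (1 : ℤ) else 0) = q := by
    rw [Fintype.sum_prod_type_right]; simp [hq]
  have c2 : ∑ p : F × F, (if p.2 = 0 then (1 : ℤ) else 0) = q := by
    rw [Fintype.sum_prod_type]; simp [hq]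
  have c3 : ∑ p : F × F, (if p.1 * p.2 = 1 then (1 : ℤ) else 0) ≤ q := by
    rw [Fintype.sum_prod_type]
    calc _ ≤ ∑ _s : F, (1 : ℤ) := by
          refine sum_le_sum fun s _ => ?_
          rw [sum_boole]
          have : #{t : F | s * t = 1} ≤ 1 := by
            refine card_le_one.2 fun x hx y hy => ?_
            simp only [mem_filter, mem_univ, true_and] at hx hy
            exact mul_left_cancel₀ (left_ne_zero_of_mul_eq_one hx) (hx.trans hy.symm)
          exact_mod_cast this
      _ = q := by simp [hq]
  have c4 : ∑ _p : F × F, (50 : ℤ) = 50 * q ^ 2 := by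
    simp [hq, Fintype.card_prod]; ring
  rw [sum_add_distrib, sum_add_distrib, ← mul_sum, sum_add_distrib, sum_add_distrib, c1, c2, c4,
    ← sum_filter, ← mul_sum]
  have c5 : 4 * q ^ 2 * ((q + q) + ∑ p : F × F, (if p.1 * p.2 = 1 then (1 : ℤ) else 0)) ≤
      4 * q ^ 2 * (q + q + q) := by gcongr
  nlinarith [sq_nonneg q]

end FiniteField

/-- The Kloosterman sum `∑ ψ (a u + b u⁻¹)` over the units `u` of a ring. -/
noncomputable def kloostermanSum {R : Type*} [CommRing R] [Fintype Rˣ] (ψ : AddChar R ℂ)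
    (a b : R) : ℂ :=
  ∑ u : Rˣ, ψ (a * u + b * ↑u⁻¹)

/-! ### Kloosterman sums over a ring -/

section General

open Finset

variable {R : Type*} [CommRing R] [Fintype Rˣ]

theorem norm_kloostermanSum_le [Finite R] (ψ : AddChar R ℂ) (a b : R) :
    ‖kloostermanSum ψ a b‖ ≤ Fintype.card Rˣ := by
  refine (norm_sum_le _ _).trans ?_
  simp [AddChar.norm_apply]

theorem kloostermanSum_unit_mul (ψ : AddChar R ℂ) (a b : R) (c : Rˣ) :
    kloostermanSum ψ (a * c) (b * ↑c⁻¹) = kloostermanSum ψ a b := by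
  unfold kloostermanSum
  refine Fintype.sum_equiv (Equiv.mulLeft c) _ _ fun u => ?_
  simp only [Equiv.coe_mulLeft, mul_inv_rev, Units.val_mul]
  congr 1; ring

end General

/-! ### The sixth moment over a finite field -/

section FiniteField

open Finset

variable {F : Type*} [Field F] [Fintype F] [DecidableEq F]

theorem sum_norm_sq_sum_mul_addChar {ψ : AddChar F ℂ} (hψ : ψ.IsPrimitive) (f : F → ℂ) :
    ∑ a : F, ‖∑ s : F, f s * ψ (a * s)‖ ^ 2 = Fintype.card F * ∑ s : F, ‖f s‖ ^ 2 := by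
  have h : ∀ a : F, ((‖∑ s : F, f s * ψ (a * s)‖ ^ 2 : ℝ) : ℂ) =
      ∑ s : F, ∑ t : F, f s * starRingEnd ℂ (f t) * ψ (a * (s - t)) := by
    intro a
    rw [Complex.ofReal_pow, ← Complex.mul_conj', map_sum, sum_mul_sum]
    refine sum_congr rfl fun s _ => sum_congr rfl fun t _ => ?_
    rw [map_mul (starRingEnd ℂ), ← AddChar.map_neg_eq_conj, mul_sub, sub_eq_add_neg,
      AddChar.map_add_eq_mul]
    ring
  have : ((∑ a : F, ‖∑ s : F, f s * ψ (a * s)‖ ^ 2 : ℝ) : ℂ) =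
      ((Fintype.card F * ∑ s : F, ‖f s‖ ^ 2 : ℝ) : ℂ) := by
    rw [Complex.ofReal_sum, sum_congr rfl fun a _ => h a, sum_comm]
    push_cast
    rw [mul_sum]
    refine sum_congr rfl fun s _ => ?_
    rw [sum_comm, sum_eq_single s]
    · rw [← mul_sum, AddChar.sum_mulShift _ hψ]
      simp only [sub_self, if_true, Complex.mul_conj']
      ring
    · intro t _ ht
      rw [← mul_sum, AddChar.sum_mulShift _ hψ, if_neg (sub_ne_zero.2 ht.symm)]
      simp
    · simp
  exact_mod_cast this

theorem kloostermanSum_pow_three (ψ : AddChar F ℂ) (a b : F) :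
    kloostermanSum ψ a b ^ 3 =
      ∑ s : F, ∑ t : F, (invTripleCount s t : ℂ) * ψ (b * t) * ψ (a * s) := by
  have h1 : kloostermanSum ψ a b ^ 3 = ∑ v : Fˣ × Fˣ × Fˣ,
      ψ (a * ((v.1 : F) + (v.2.1 + v.2.2)) +
        b * ((v.1 : F)⁻¹ + ((v.2.1 : F)⁻¹ + (v.2.2 : F)⁻¹))) := by
    rw [Fintype.sum_prod_type, pow_succ', sq]
    unfold kloostermanSum
    rw [sum_mul_sum, sum_mul_sum]
    refine sum_congr rfl fun x _ => ?_
    rw [Fintype.sum_prod_type]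
    refine sum_congr rfl fun y _ => ?_
    rw [mul_sum]
    refine sum_congr rfl fun z _ => ?_
    simp only [Units.val_inv_eq_inv_val, ← AddChar.map_add_eq_mul]
    congr 1; ring
  rw [h1, ← Fintype.sum_prod_type' fun s t =>
    (invTripleCount s t : ℂ) * ψ (b * t) * ψ (a * s),
    ← sum_fiberwise univ fun v : Fˣ × Fˣ × Fˣ => ((v.1 : F) + (v.2.1 + v.2.2),
      (v.1 : F)⁻¹ + ((v.2.1 : F)⁻¹ + (v.2.2 : F)⁻¹))]
  refine sum_congr rfl fun p _ => ?_
  have hc : ∀ v ∈ univ.filter (fun v : Fˣ × Fˣ × Fˣ => ((v.1 : F) + (v.2.1 + v.2.2),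
      (v.1 : F)⁻¹ + ((v.2.1 : F)⁻¹ + (v.2.2 : F)⁻¹)) = p),
      ψ (a * ((v.1 : F) + (v.2.1 + v.2.2)) +
        b * ((v.1 : F)⁻¹ + ((v.2.1 : F)⁻¹ + (v.2.2 : F)⁻¹))) = ψ (b * p.2) * ψ (a * p.1) := by
    intro v hv
    rw [← (mem_filter.1 hv).2, ← AddChar.map_add_eq_mul, add_comm]
  rw [sum_congr rfl hc, sum_const, nsmul_eq_mul, mul_assoc]
  congr 2
  unfold invTripleCount
  simp only [Prod.ext_iff]

/-- The mean value `q` may be removed because `∑ ψ (a s)` over `s` vanishes for `a ≠ 0`. Only after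
this removal is the mean-square estimate effective. -/
theorem kloostermanSum_pow_three_eq_sum_sub {ψ : AddChar F ℂ} (hψ : ψ.IsPrimitive) {a : F}
    (ha : a ≠ 0) (b : F) :
    kloostermanSum ψ a b ^ 3 =
      ∑ s : F, (∑ t : F, (((invTripleCount s t : ℤ) - Fintype.card F : ℤ) : ℂ) * ψ (b * t)) *
        ψ (a * s) := by
  have h0 : ∑ s : F, (∑ t : F, (Fintype.card F : ℂ) * ψ (b * t)) * ψ (a * s) = 0 := by
    simp only [mul_comm a]
    rw [← mul_sum, AddChar.sum_mulShift _ hψ, if_neg ha, Nat.cast_zero, mul_zero]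
  rw [kloostermanSum_pow_three, ← sub_zero (∑ s : F, _), ← h0, ← sum_sub_distrib]
  refine sum_congr rfl fun s _ => ?_
  rw [← sum_mul, ← sub_mul, ← sum_sub_distrib]
  congr 1
  refine sum_congr rfl fun t _ => ?_
  push_cast; ring

/-- Parseval in both variables bounds the sum of `|G|²` over all `(a, b)` by `70 q⁵`. The orbit of
`(a, b)` under `(a c, b c⁻¹)` has `q - 1` points because `a ≠ 0`, and each contributes `|K|⁶`. -/
theorem norm_kloostermanSum_pow_three_le (h2 : ringChar F ≠ 2) {ψ : AddChar F ℂ}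
    (hψ : ψ.IsPrimitive) {a : F} (ha : a ≠ 0) (b : F) :
    ‖kloostermanSum ψ a b‖ ^ 3 ≤ 12 * (Fintype.card F : ℝ) ^ 2 := by
  set q : ℝ := (Fintype.card F : ℝ) with hq
  have hq2 : 2 ≤ q := by rw [hq]; exact_mod_cast Fintype.one_lt_card
  let f : F → F → ℂ := fun s t => (((invTripleCount s t : ℤ) - Fintype.card F : ℤ) : ℂ)
  let G : F → F → ℂ := fun a b => ∑ s : F, (∑ t : F, f s t * ψ (b * t)) * ψ (a * s)
  have hG : ∀ a b : F, a ≠ 0 → kloostermanSum ψ a b ^ 3 = G a b := fun a b ha =>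
    kloostermanSum_pow_three_eq_sum_sub hψ ha b
  have parseval : ∑ b : F, ∑ a : F, ‖G a b‖ ^ 2 = q ^ 2 * ∑ s : F, ∑ t : F, ‖f s t‖ ^ 2 := by
    simp only [G, sum_norm_sq_sum_mul_addChar hψ]
    rw [← mul_sum, sum_comm]
    simp only [sum_norm_sq_sum_mul_addChar hψ]
    rw [← mul_sum]; ring
  have hf : ∑ s : F, ∑ t : F, ‖f s t‖ ^ 2 ≤ 70 * q ^ 3 := by
    have := sum_sq_invTripleCount_sub_card_le (F := F) h2
    rw [Fintype.sum_prod_type] at this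
    have h' : ((∑ s : F, ∑ t : F, ((invTripleCount s t : ℤ) - Fintype.card F) ^ 2 : ℤ) : ℝ) ≤
      ((70 * (Fintype.card F : ℤ) ^ 3 : ℤ) : ℝ) := by exact_mod_cast this
    convert h' using 1
    · push_cast
      refine sum_congr rfl fun s _ => sum_congr rfl fun t _ => ?_
      simp only [f, Complex.norm_intCast, sq_abs]
      push_cast; rfl
    · push_cast; rfl
  have horbit : ∑ c : Fˣ, ‖G (a * c) (b * (↑c⁻¹ : F))‖ ^ 2 ≤ ∑ b : F, ∑ a : F, ‖G a b‖ ^ 2 := by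
    rw [← Fintype.sum_prod_type' fun b a => ‖G a b‖ ^ 2]
    have hinj : Function.Injective fun c : Fˣ => (b * (↑c⁻¹ : F), a * (c : F)) := fun c d h =>
      Units.ext (mul_left_cancel₀ ha (Prod.ext_iff.1 h).2)
    refine (sum_map univ ⟨_, hinj⟩ fun p : F × F => ‖G p.2 p.1‖ ^ 2).symm.trans_le ?_
    exact sum_le_sum_of_subset_of_nonneg (subset_univ _) fun _ _ _ => by positivity
  have hcount : ∑ c : Fˣ, ‖G (a * c) (b * (↑c⁻¹ : F))‖ ^ 2 =
      (q - 1) * (‖kloostermanSum ψ a b‖ ^ 3) ^ 2 := by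
    have : ∀ c : Fˣ, ‖G (a * c) (b * (↑c⁻¹ : F))‖ ^ 2 = (‖kloostermanSum ψ a b‖ ^ 3) ^ 2 := by
      intro c
      rw [← hG _ _ (mul_ne_zero ha c.ne_zero), kloostermanSum_unit_mul, norm_pow]
    rw [sum_congr rfl fun c _ => this c, sum_const, card_univ, nsmul_eq_mul, Fintype.card_units,
      Nat.cast_sub Fintype.card_pos, Nat.cast_one]
  rw [hcount, parseval] at horbit
  have h1 : (q - 1) * (‖kloostermanSum ψ a b‖ ^ 3) ^ 2 ≤ q ^ 2 * (70 * q ^ 3) :=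
    horbit.trans (by gcongr)
  -- Here `q - 1 ≥ q / 2`, and `12` is admissible because `12² / 2 = 72 ≥ 70`.
  have h3 : q / 2 * (‖kloostermanSum ψ a b‖ ^ 3) ^ 2 ≤ q / 2 * (12 * q ^ 2) ^ 2 := by
    calc _ ≤ (q - 1) * (‖kloostermanSum ψ a b‖ ^ 3) ^ 2 := by gcongr; linarith
      _ ≤ _ := h1.trans (by nlinarith [show 0 ≤ q ^ 5 by positivity])
  exact le_of_sq_le_sq (le_of_mul_le_mul_left h3 (by linarith)) (by positivity)

end FiniteField

/-! ### Stationary phase modulo prime powers -/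

section PrimePower

open Finset

/-- As `π² = 0`, the element `1 + y π` is a unit with inverse `1 - y π`. Multiplying `u` by it and
averaging over all `y` annihilates every term whose phase has nonzero derivative along `π`. -/
theorem norm_kloostermanSum_le_card_of_sq_eq_zero {R : Type*} [CommRing R] [Fintype R]
    [DecidableEq R] {ψ : AddChar R ℂ} (hψ : ψ.IsPrimitive) (a b : R) {π : R} (hπ : π ^ 2 = 0) :
    ‖kloostermanSum ψ a b‖ ≤ #{u : Rˣ | (a * u - b * ↑u⁻¹) * π = 0} := by
  have hy : ∀ y : R, kloostermanSum ψ a b =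
      ∑ u : Rˣ, ψ (a * u + b * ↑u⁻¹) * ψ (y * ((a * u - b * ↑u⁻¹) * π)) := by
    intro y
    let e : Rˣ := ⟨1 + y * π, 1 - y * π, by linear_combination -y ^ 2 * hπ,
      by linear_combination -y ^ 2 * hπ⟩
    rw [← kloostermanSum_unit_mul ψ a b e]
    refine sum_congr rfl fun u _ => ?_
    rw [← AddChar.map_add_eq_mul]
    congr 1
    change a * (1 + y * π) * u + b * (1 - y * π) * ↑u⁻¹ = _
    ring
  have hsum : (Fintype.card R : ℂ) * kloostermanSum ψ a b =
      Fintype.card R * ∑ u ∈ univ.filter (fun u : Rˣ => (a * u - b * ↑u⁻¹) * π = 0),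
        ψ (a * u + b * ↑u⁻¹) := by
    calc (Fintype.card R : ℂ) * kloostermanSum ψ a b = ∑ _y : R, kloostermanSum ψ a b := by
          rw [sum_const, card_univ, nsmul_eq_mul]
      _ = ∑ y : R, ∑ u : Rˣ, ψ (a * u + b * ↑u⁻¹) * ψ (y * ((a * u - b * ↑u⁻¹) * π)) :=
          sum_congr rfl fun y _ => hy y
      _ = _ := by
          rw [sum_comm, mul_sum, sum_filter]
          refine sum_congr rfl fun u _ => ?_
          rw [← mul_sum, AddChar.sum_mulShift _ hψ]
          split_ifs <;> push_cast <;> ring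
  have : Nonempty R := ⟨0⟩
  rw [mul_left_cancel₀ (Nat.cast_ne_zero.2 Fintype.card_ne_zero) hsum]
  refine (norm_sum_le _ _).trans ?_
  simp [AddChar.norm_apply]

theorem ZMod.isUnit_or_prime_dvd {p j : ℕ} (hp : p.Prime) (z : ZMod (p ^ j)) :
    IsUnit z ∨ (p : ZMod (p ^ j)) ∣ z := by
  have : NeZero (p ^ j) := ⟨pow_ne_zero _ hp.ne_zero⟩
  rw [← ZMod.natCast_zmod_val z, ZMod.isUnit_iff_coprime]
  by_cases h : p ∣ z.val
  · exact Or.inr (Nat.cast_dvd_cast h)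
  · exact Or.inl (Nat.Coprime.pow_right _ ((hp.coprime_iff_not_dvd.2 h).symm))

theorem ZMod.not_prime_dvd_unit {p j : ℕ} (hp : p.Prime) (hj : j ≠ 0) (u : (ZMod (p ^ j))ˣ) :
    ¬(p : ZMod (p ^ j)) ∣ (u : ZMod (p ^ j)) := by
  intro h
  have h1 := isUnit_of_dvd_unit h u.isUnit
  rw [ZMod.isUnit_iff_coprime, Nat.coprime_pow_right_iff (Nat.pos_of_ne_zero hj),
    Nat.coprime_self] at h1
  exact hp.one_lt.ne' h1

/-- If `u - v` or `u + v` is a unit it can be cancelled. Otherwise `p ∣ 2 u`, so `p = 2`; writing `u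
- v = 2 x` and `u + v = 2 (x + v)`, one of `x`, `x + v` is a unit because `v` is odd. The factor `2`
in the conclusion pays for this case. -/
theorem ZMod.two_mul_sub_eq_zero_or_add {p j : ℕ} (hp : p.Prime) (hj : j ≠ 0)
    (u v : (ZMod (p ^ j))ˣ) {π : ZMod (p ^ j)} (h : ((u : ZMod (p ^ j)) ^ 2 - v ^ 2) * π = 0) :
    2 * π * ((u : ZMod (p ^ j)) - v) = 0 ∨ 2 * π * ((u : ZMod (p ^ j)) + v) = 0 := by
  rcases ZMod.isUnit_or_prime_dvd hp ((u : ZMod (p ^ j)) - (v : ZMod (p ^ j))) with h1 | ⟨x, hx⟩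
  · right
    refine h1.mul_left_cancel ?_
    linear_combination 2 * h
  rcases ZMod.isUnit_or_prime_dvd hp ((u : ZMod (p ^ j)) + (v : ZMod (p ^ j))) with h1 | ⟨y, hy⟩
  · left
    refine h1.mul_left_cancel ?_
    linear_combination 2 * h
  have h2u : (p : ZMod (p ^ j)) ∣ ((2 : ℕ) : ZMod (p ^ j)) * u :=
    ⟨x + y, by push_cast; linear_combination hx + hy⟩
  have hp2 : p = 2 := by
    by_contra hne
    have h2 : IsUnit ((2 : ℕ) : ZMod (p ^ j)) := by
      rw [ZMod.isUnit_iff_coprime]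
      exact Nat.Coprime.pow_right _ ((Nat.coprime_primes Nat.prime_two hp).2 (Ne.symm hne))
    rw [← h2.unit_spec, ← Units.val_mul] at h2u
    exact ZMod.not_prime_dvd_unit hp hj _ h2u
  subst hp2
  push_cast at hx hy
  have hyx : (u : ZMod (2 ^ j)) + v = 2 * (x + v) := by linear_combination hx
  rcases ZMod.isUnit_or_prime_dvd hp x with h3 | ⟨z, hz⟩
  · right
    refine h3.mul_left_cancel ?_
    linear_combination h - π * (u + v) * hx
  rcases ZMod.isUnit_or_prime_dvd hp (x + (v : ZMod (2 ^ j))) with h3 | ⟨w, hw⟩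
  · left
    refine h3.mul_left_cancel ?_
    linear_combination h - π * (u - v) * hyx
  · exact absurd ⟨w - z, by push_cast at hw hz ⊢; linear_combination hw - hz⟩ (ZMod.not_prime_dvd_unit hp hj v)

theorem card_units_smul_sub_eq_zero_le {n : ℕ} [NeZero n] {k : ℕ} (hk : 0 < k) (c : ZMod n) :
    #{u : (ZMod n)ˣ | (k : ZMod n) * ((u : ZMod n) - c) = 0} ≤ k := by
  refine le_trans ?_ (IsAddCyclic.card_nsmul_eq_zero_le (α := ZMod n) hk)
  refine card_le_card_of_injOn (fun u => (u : ZMod n) - c) ?_ ?_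
  · intro u hu
    simpa using hu
  · intro u _ v _ h
    exact Units.ext (sub_left_injective h)

/-- Once one solution `v` is fixed, every other satisfies `(u² - v²) p^m = 0`. Hence `u - v` or `u +
v` is killed by `2 p^m`, which leaves at most `2 p^m` choices in each case. -/
theorem card_stationary_points_le {p j m : ℕ} [NeZero (p ^ j)] (hp : p.Prime) (hj : j ≠ 0)
    {a b : ZMod (p ^ j)} (ha : IsUnit a) :
    #{u : (ZMod (p ^ j))ˣ | (a * u - b * ↑u⁻¹) * (p : ZMod (p ^ j)) ^ m = 0} ≤ 4 * p ^ m := by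
  set S := univ.filter fun u : (ZMod (p ^ j))ˣ =>
    (a * u - b * ↑u⁻¹) * (p : ZMod (p ^ j)) ^ m = 0 with hS
  rcases S.eq_empty_or_nonempty with h | ⟨v, hv⟩
  · simp [h]
  have hpm : 0 < 2 * p ^ m := by have := hp.pos; positivity
  have key : ∀ u ∈ S, (a * u ^ 2 - b) * (p : ZMod (p ^ j)) ^ m = 0 := by
    intro u hu
    have h := (mem_filter.1 hu).2
    have hu1 : (↑u⁻¹ : ZMod (p ^ j)) * u = 1 := u.inv_mul
    linear_combination u * h + b * p ^ m * hu1
  have hsub : S ⊆ univ.filter (fun u : (ZMod (p ^ j))ˣ =>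
      ((2 * p ^ m : ℕ) : ZMod (p ^ j)) * ((u : ZMod (p ^ j)) - v) = 0) ∪
      univ.filter (fun u : (ZMod (p ^ j))ˣ =>
      ((2 * p ^ m : ℕ) : ZMod (p ^ j)) * ((u : ZMod (p ^ j)) - (-v : ZMod (p ^ j))) = 0) := by
    intro u hu
    simp only [mem_union, mem_filter, mem_univ, true_and, sub_neg_eq_add]
    push_cast
    refine ZMod.two_mul_sub_eq_zero_or_add hp hj u v (ha.mul_left_cancel ?_)
    linear_combination key u hu - key v hv
  refine (card_le_card hsub).trans ((card_union_le _ _).trans ?_)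
  have h1 := card_units_smul_sub_eq_zero_le hpm (v : ZMod (p ^ j))
  have h2 := card_units_smul_sub_eq_zero_le hpm (-v : ZMod (p ^ j))
  omega

theorem ZMod.stdAddChar_mul_eq {p c : ℕ} [NeZero c] [NeZero (p * c)] (x : ZMod (p * c)) :
    ZMod.stdAddChar ((p : ZMod (p * c)) * x) =
      ZMod.stdAddChar (ZMod.castHom (dvd_mul_left c p) (ZMod c) x) := by
  obtain ⟨n, rfl⟩ := ZMod.intCast_surjective x
  have hp : (p : ℂ) ≠ 0 := Nat.cast_ne_zero.2 (left_ne_zero_of_mul (NeZero.ne (p * c)))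
  have hc : (c : ℂ) ≠ 0 := Nat.cast_ne_zero.2 (NeZero.ne c)
  have h := ZMod.stdAddChar_coe (N := p * c) ((p : ℤ) * n)
  push_cast at h
  rw [h, map_intCast, ZMod.stdAddChar_coe]
  congr 1
  field_simp

/-- The summand depends only on `u` modulo `c`. Reduction of units has fibres of size `φ(p c) /
φ(c)`, which is `p` because `p ∣ c`. -/
theorem kloostermanSum_prime_mul {p c : ℕ} [NeZero c] [NeZero (p * c)] (hp : p.Prime)
    (hpc : p ∣ c) (a b : ℤ) :
    kloostermanSum (ZMod.stdAddChar : AddChar (ZMod (p * c)) ℂ) (p * a) (p * b) =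
      p * kloostermanSum (ZMod.stdAddChar : AddChar (ZMod c) ℂ) a b := by
  have hdvd : c ∣ p * c := dvd_mul_left c p
  let f := ZMod.unitsMap hdvd
  have hf : Function.Surjective f := ZMod.unitsMap_surjective hdvd
  have hfib : ∀ v : (ZMod c)ˣ, #{u | f u = v} = p := by
    have hconst : ∀ v, #{u | f u = v} = #{u | f u = 1} := fun v =>
      MonoidHom.card_fiber_eq_of_mem_range f (hf v) (hf 1)
    have h1 := card_eq_sum_card_fiberwise (f := f) (s := univ) (t := univ)
      fun _ _ => mem_coe.2 (mem_univ _)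
    rw [sum_congr rfl fun v _ => hconst v, sum_const, card_univ, card_univ,
      ZMod.card_units_eq_totient, ZMod.card_units_eq_totient,
      Nat.totient_mul_of_prime_of_dvd hp hpc, smul_eq_mul, mul_comm] at h1
    have h2 := Nat.eq_of_mul_eq_mul_left (Nat.totient_pos.2 (NeZero.pos c)) h1
    intro v
    exact (hconst v).trans h2.symm
  unfold kloostermanSum
  rw [← sum_fiberwise univ f, mul_sum]
  refine sum_congr rfl fun v _ => ?_
  have hterm : ∀ u ∈ univ.filter (fun u => f u = v),
      (ZMod.stdAddChar : AddChar (ZMod (p * c)) ℂ) (p * a * u + p * b * ↑u⁻¹) =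
        (ZMod.stdAddChar : AddChar (ZMod c) ℂ) (a * v + b * ↑v⁻¹) := by
    intro u hu
    rw [← (mem_filter.1 hu).2, mul_assoc, mul_assoc, ← mul_add, ZMod.stdAddChar_mul_eq]
    simp only [map_add, map_mul, map_intCast, ← map_inv]
    rfl
  rw [sum_congr rfl hterm, sum_const, nsmul_eq_mul]
  congr 1
  exact_mod_cast hfib v

theorem norm_kloostermanSum_prime_le {p : ℕ} [NeZero p] (hp : p.Prime) (a b : ℤ) :
    ‖kloostermanSum (ZMod.stdAddChar : AddChar (ZMod p) ℂ) a b‖ ^ 3 ≤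
      64 * (p : ℝ) ^ 2 * Int.gcd a p := by
  have : Fact p.Prime := ⟨hp⟩
  have hp2 : (2 : ℝ) ≤ p := by exact_mod_cast hp.two_le
  have htriv : ‖kloostermanSum (ZMod.stdAddChar : AddChar (ZMod p) ℂ) a b‖ ≤ p := by
    refine (norm_kloostermanSum_le _ _ _).trans ?_
    rw [ZMod.card_units_eq_totient]
    exact_mod_cast Nat.totient_le p
  have htriv3 := pow_le_pow_left₀ (norm_nonneg _) htriv 3
  have hg : (1 : ℝ) ≤ Int.gcd a p := by
    exact_mod_cast Int.gcd_pos_of_ne_zero_right _ (by exact_mod_cast hp.ne_zero)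
  by_cases ha : (p : ℤ) ∣ a
  · rw [Int.gcd_eq_natAbs_right ha, Int.natAbs_natCast]
    nlinarith [pow_nonneg (Nat.cast_nonneg p : (0 : ℝ) ≤ p) 3]
  by_cases h2 : p = 2
  · have : (p : ℝ) = 2 := by exact_mod_cast h2
    nlinarith [sq_nonneg (p : ℝ)]
  have ha' : (a : ZMod p) ≠ 0 := by rwa [Ne, ZMod.intCast_zmod_eq_zero_iff_dvd]
  have h := norm_kloostermanSum_pow_three_le (F := ZMod p)
    (by rwa [ZMod.ringChar_zmod_n]) (ZMod.isPrimitive_stdAddChar p) ha' (b : ZMod p)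
  rw [ZMod.card] at h
  nlinarith [sq_nonneg (p : ℝ)]

theorem ZMod.isUnit_intCast_of_not_dvd {p j : ℕ} (hp : p.Prime) (hj : j ≠ 0) {a : ℤ}
    (ha : ¬(p : ℤ) ∣ a) : IsUnit (a : ZMod (p ^ j)) := by
  refine (ZMod.isUnit_or_prime_dvd hp _).resolve_right fun h => ha ?_
  have := map_dvd (ZMod.castHom (dvd_pow_self p hj) (ZMod p)) h
  rw [map_natCast, map_intCast, CharP.cast_eq_zero, zero_dvd_iff] at this
  exact (ZMod.intCast_zmod_eq_zero_iff_dvd a p).1 this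

/-- Take `π = p^⌈j/2⌉`. If `p ∣ a` then `p ∤ b`, so `a u - b u⁻¹` is always a unit and there are no
stationary points; otherwise `a` is a unit and they have been counted. -/
theorem norm_kloostermanSum_prime_pow_le_of_not_dvd {p j : ℕ} [NeZero (p ^ j)] (hp : p.Prime)
    (hj : 2 ≤ j) {a b : ℤ} (hab : ¬((p : ℤ) ∣ a ∧ (p : ℤ) ∣ b)) :
    ‖kloostermanSum (ZMod.stdAddChar : AddChar (ZMod (p ^ j)) ℂ) a b‖ ≤
      4 * p ^ ((j + 1) / 2) := by
  have hj0 : j ≠ 0 := by omega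
  have hsq : ((p : ZMod (p ^ j)) ^ ((j + 1) / 2)) ^ 2 = 0 := by
    rw [← pow_mul, ← Nat.cast_pow, ZMod.natCast_eq_zero_iff]
    exact pow_dvd_pow p (by omega)
  have hle := norm_kloostermanSum_le_card_of_sq_eq_zero
    (ZMod.isPrimitive_stdAddChar (p ^ j)) (a : ZMod (p ^ j)) (b : ZMod (p ^ j)) hsq
  refine hle.trans ?_
  by_cases ha : (p : ℤ) ∣ a
  · have hb : IsUnit (b : ZMod (p ^ j)) :=
      ZMod.isUnit_intCast_of_not_dvd hp hj0 fun h => hab ⟨ha, h⟩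
    have hempty : #{u : (ZMod (p ^ j))ˣ | ((a : ZMod (p ^ j)) * u - b * ↑u⁻¹) *
        (p : ZMod (p ^ j)) ^ ((j + 1) / 2) = 0} = 0 := by
      rw [card_eq_zero, filter_eq_empty_iff]
      intro u _ h
      have hunit : IsUnit ((a : ZMod (p ^ j)) * u - b * ↑u⁻¹) := by
        refine (ZMod.isUnit_or_prime_dvd hp _).resolve_right fun h => ?_
        have h1 : (p : ZMod (p ^ j)) ∣ a * u := by
          obtain ⟨d, rfl⟩ := ha
          push_cast
          exact ⟨d * u, by ring⟩
        have h2 := (dvd_sub_right h1).1 h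
        exact ZMod.not_prime_dvd_unit hp hj0 (hb.unit * u⁻¹) (by simpa using h2)
      rw [hunit.mul_right_eq_zero, ← Nat.cast_pow, ZMod.natCast_eq_zero_iff,
        Nat.pow_dvd_pow_iff_le_right hp.one_lt] at h
      omega
    rw [hempty, Nat.cast_zero]
    positivity
  · exact_mod_cast card_stationary_points_le hp hj0 (ZMod.isUnit_intCast_of_not_dvd hp hj0 ha)

theorem norm_kloostermanSum_prime_pow_le {p j : ℕ} (hp : p.Prime) (hj : j ≠ 0) :
    ∀ (c : ℕ) [NeZero c], c = p ^ j → ∀ a b : ℤ,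
    ‖kloostermanSum (ZMod.stdAddChar : AddChar (ZMod c) ℂ) a b‖ ^ 3 ≤
      64 * (c : ℝ) ^ 2 * Int.gcd a c := by
  induction j with
  | zero => exact absurd rfl hj
  | succ j ih =>
    intro c _ hc a b
    rcases Nat.eq_zero_or_pos j with rfl | hj0
    · obtain rfl : c = p := by simpa using hc
      exact norm_kloostermanSum_prime_le hp a b
    by_cases hab : (p : ℤ) ∣ a ∧ (p : ℤ) ∣ b
    · obtain ⟨⟨a, rfl⟩, ⟨b, rfl⟩⟩ := hab
      obtain rfl : c = p * p ^ j := by rw [hc, pow_succ']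
      have : NeZero (p ^ j) := ⟨pow_ne_zero _ hp.ne_zero⟩
      have h := ih hj0.ne' (p ^ j) rfl a b
      push_cast
      rw [kloostermanSum_prime_mul hp (dvd_pow_self p hj0.ne'), norm_mul, Int.gcd_mul_left,
        Complex.norm_natCast]
      push_cast at h ⊢
      rw [mul_pow]
      calc _ ≤ (p : ℝ) ^ 3 * _ := mul_le_mul_of_nonneg_left h (by positivity)
        _ = _ := by simp only [Int.natAbs_natCast]; ring
    · subst hc
      have h := norm_kloostermanSum_prime_pow_le_of_not_dvd (j := j + 1) hp (by omega) hab
      have hg : (1 : ℝ) ≤ Int.gcd a (p ^ (j + 1) : ℕ) := by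
        exact_mod_cast Int.gcd_pos_of_ne_zero_right _ (by exact_mod_cast NeZero.ne (p ^ (j + 1)))
      have hp1 : (1 : ℝ) ≤ p := by exact_mod_cast hp.one_le
      calc _ ≤ (4 * (p : ℝ) ^ ((j + 1 + 1) / 2)) ^ 3 := by gcongr
        _ = 64 * (p : ℝ) ^ ((j + 1 + 1) / 2 * 3) := by rw [mul_pow, ← pow_mul]; norm_num
        _ ≤ 64 * (p : ℝ) ^ ((j + 1) * 2) := by
            refine mul_le_mul_of_nonneg_left (pow_le_pow_right₀ hp1 ?_) (by norm_num)
            -- This is `3 ⌈i/2⌉ ≤ 2 i` for `i = j + 1 ≥ 2`, with equality at `i = 3`: there the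
            -- exponent `2/3` is the limit of the method.
            omega
        _ = 64 * ((p ^ (j + 1) : ℕ) : ℝ) ^ 2 * 1 := by push_cast; rw [← pow_mul, mul_one]
        _ ≤ _ := by gcongr

end PrimePower

/-! ### Twisted multiplicativity and general moduli -/

section Multiplicativity

open Finset

/-- Partial fractions: `1 / (m n) = t / m + s / n`. -/
theorem ZMod.stdAddChar_eq_mul {m n : ℕ} [NeZero m] [NeZero n] [NeZero (m * n)] {s t : ℤ}
    (hst : s * m + t * n = 1) (x : ZMod (m * n)) :
    ZMod.stdAddChar x =
      ZMod.stdAddChar ((t : ZMod m) * ZMod.castHom (dvd_mul_right m n) (ZMod m) x) *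
        ZMod.stdAddChar ((s : ZMod n) * ZMod.castHom (dvd_mul_left n m) (ZMod n) x) := by
  obtain ⟨k, rfl⟩ := ZMod.intCast_surjective x
  have hm : (m : ℂ) ≠ 0 := Nat.cast_ne_zero.2 (NeZero.ne m)
  have hn : (n : ℂ) ≠ 0 := Nat.cast_ne_zero.2 (NeZero.ne n)
  have hst' : (s : ℂ) * m + t * n = 1 := by exact_mod_cast hst
  simp only [map_intCast, ← Int.cast_mul, ZMod.stdAddChar_coe]
  rw [← Complex.exp_add]
  congr 1
  push_cast
  field_simp
  linear_combination -(k : ℂ) * hst'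

theorem kloostermanSum_mul_of_coprime {m n : ℕ} [NeZero m] [NeZero n] [NeZero (m * n)]
    (hmn : m.Coprime n) {s t : ℤ} (hst : s * m + t * n = 1) (a b : ℤ) :
    kloostermanSum (ZMod.stdAddChar : AddChar (ZMod (m * n)) ℂ) a b =
      kloostermanSum (ZMod.stdAddChar : AddChar (ZMod m) ℂ) (t * a : ℤ) (t * b : ℤ) *
        kloostermanSum (ZMod.stdAddChar : AddChar (ZMod n) ℂ) (s * a : ℤ) (s * b : ℤ) := by
  unfold kloostermanSum
  rw [sum_mul_sum, ← Fintype.sum_prod_type']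
  refine Fintype.sum_equiv ((Units.mapEquiv (ZMod.chineseRemainder hmn).toMulEquiv).trans
    MulEquiv.prodUnits).toEquiv _ _ fun u => ?_
  rw [ZMod.stdAddChar_eq_mul hst]
  have h1 : ∀ x : ZMod (m * n), (ZMod.chineseRemainder hmn x).1 =
      ZMod.castHom (dvd_mul_right m n) (ZMod m) x := fun x =>
    RingHom.congr_fun (Subsingleton.elim ((RingHom.fst _ _).comp
      (ZMod.chineseRemainder hmn : ZMod (m * n) →+* ZMod m × ZMod n)) _) x
  have h2 : ∀ x : ZMod (m * n), (ZMod.chineseRemainder hmn x).2 =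
      ZMod.castHom (dvd_mul_left n m) (ZMod n) x := fun x =>
    RingHom.congr_fun (Subsingleton.elim ((RingHom.snd _ _).comp
      (ZMod.chineseRemainder hmn : ZMod (m * n) →+* ZMod m × ZMod n)) _) x
  congr 2
  · rw [map_add, map_mul, map_mul, map_intCast, map_intCast, ← h1, ← h1]
    push_cast
    rw [mul_add, ← mul_assoc, ← mul_assoc]
    rfl
  · rw [map_add, map_mul, map_mul, map_intCast, map_intCast, ← h2, ← h2]
    push_cast
    rw [mul_add, ← mul_assoc, ← mul_assoc]
    rfl

theorem Int.gcd_mul_left_of_add_eq_one {m n : ℕ} {s t : ℤ} (hst : s * m + t * n = 1) (a : ℤ) :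
    Int.gcd (t * a) m = Int.gcd a m := by
  have : IsCoprime t (m : ℤ) := ⟨n, s, by linear_combination hst⟩
  rw [Int.gcd_def, Int.gcd_def, Int.natAbs_mul]
  exact Nat.Coprime.gcd_mul_left_cancel _ (Int.isCoprime_iff_gcd_eq_one.1 this)

theorem norm_kloostermanSum_pow_three_le_primeFactors (c : ℕ) : ∀ [NeZero c] (a b : ℤ),
    ‖kloostermanSum (ZMod.stdAddChar : AddChar (ZMod c) ℂ) a b‖ ^ 3 ≤
      64 ^ c.primeFactors.card * (c : ℝ) ^ 2 * Int.gcd a c := by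
  induction c using Nat.recOnPosPrimePosCoprime with
  | prime_pow p j hp hj =>
    intro _ a b
    rw [Nat.primeFactors_prime_pow hj.ne' hp, card_singleton, pow_one]
    exact norm_kloostermanSum_prime_pow_le hp hj.ne' _ rfl a b
  | zero =>
    intro h
    exact absurd rfl h.out
  | one =>
    intro _ a b
    have h := norm_kloostermanSum_le (ZMod.stdAddChar : AddChar (ZMod 1) ℂ) a b
    simp at h ⊢
    exact pow_le_one₀ (norm_nonneg _) h
  | coprime m n hm hn hmn ihm ihn =>
    intro _ a b
    have : NeZero m := ⟨by omega⟩
    have : NeZero n := ⟨by omega⟩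
    obtain ⟨s, t, hst⟩ := Nat.isCoprime_iff_coprime.2 hmn
    have h1 := ihm (t * a) (t * b)
    have h2 := ihn (s * a) (s * b)
    rw [Int.gcd_mul_left_of_add_eq_one hst] at h1
    rw [Int.gcd_mul_left_of_add_eq_one (by rw [add_comm]; exact hst)] at h2
    rw [kloostermanSum_mul_of_coprime hmn hst, norm_mul, mul_pow,
      Nat.Coprime.primeFactors_mul hmn, card_union_of_disjoint hmn.disjoint_primeFactors]
    have hg : Int.gcd a (m * n : ℕ) = Int.gcd a m * Int.gcd a n := by
      simp only [Int.gcd_def, Int.natAbs_natCast]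
      exact Nat.Coprime.gcd_mul _ hmn
    calc _ ≤ _ := mul_le_mul h1 h2 (by positivity) (by positivity)
      _ = _ := by rw [hg]; push_cast; ring

/-- A prime `p ≥ D^(1/ε)` pays for its own factor, since `D ≤ p^ε`. Fewer than `M + 1` primes are
smaller, and together they cost at most `D ^ M`. -/
theorem exists_pow_card_primeFactors_le {D ε : ℝ} (hD : 1 ≤ D) (hε : 0 < ε) :
    ∃ C : ℝ, 0 < C ∧ ∀ c : ℕ, c ≠ 0 → D ^ c.primeFactors.card ≤ C * (c : ℝ) ^ ε := by
  set M := ⌈D ^ (1 / ε)⌉₊ with hM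
  refine ⟨D ^ M, by positivity, fun c hc => ?_⟩
  have hbig : ∀ p ∈ c.primeFactors, D ≤ (if p < M then D else 1) * (p : ℝ) ^ ε := by
    intro p hp
    have hp1 : (1 : ℝ) ≤ p := by exact_mod_cast (Nat.prime_of_mem_primeFactors hp).one_le
    split_ifs with h
    · exact le_mul_of_one_le_right (by linarith) (Real.one_le_rpow hp1 hε.le)
    · rw [one_mul]
      have h1 : D ^ (1 / ε) ≤ p := (Nat.le_ceil _).trans (by exact_mod_cast not_lt.1 h)
      calc D = (D ^ (1 / ε)) ^ ε := by
            rw [← Real.rpow_mul (by linarith), one_div_mul_cancel hε.ne', Real.rpow_one]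
        _ ≤ _ := Real.rpow_le_rpow (by positivity) h1 hε.le
  calc D ^ c.primeFactors.card = ∏ _p ∈ c.primeFactors, D := by rw [prod_const]
    _ ≤ ∏ p ∈ c.primeFactors, (if p < M then D else 1) * (p : ℝ) ^ ε :=
        prod_le_prod (fun _ _ => by linarith) hbig
    _ = D ^ #{p ∈ c.primeFactors | p < M} * ((∏ p ∈ c.primeFactors, p : ℕ) : ℝ) ^ ε := by
        rw [prod_mul_distrib, ← prod_filter, prod_const, Nat.cast_prod,
          Real.finsetProd_rpow _ _ fun _ _ => Nat.cast_nonneg _]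
    _ ≤ D ^ M * (c : ℝ) ^ ε := by
        gcongr ?_ * ?_
        · refine pow_le_pow_right₀ hD ?_
          refine (card_le_card (t := range M) fun p hp => ?_).trans (card_range M).le
          exact mem_range.2 (mem_filter.1 hp).2
        · refine Real.rpow_le_rpow (Nat.cast_nonneg _) (Nat.cast_le.2 ?_) hε.le
          exact Nat.le_of_dvd (Nat.pos_of_ne_zero hc) (Nat.prod_primeFactors_dvd c)

theorem exists_norm_kloostermanSum_le {ε : ℝ} (hε : 0 < ε) :
    ∃ C : ℝ, 0 < C ∧ ∀ (c : ℕ) [NeZero c] (a b : ℤ),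
      ‖kloostermanSum (ZMod.stdAddChar : AddChar (ZMod c) ℂ) a b‖ ≤
        C * ((c : ℝ) ^ ((2 : ℝ) / 3 + ε) * (Nat.gcd a.natAbs c : ℝ) ^ ((1 : ℝ) / 3)) := by
  obtain ⟨C, hC, h⟩ := exists_pow_card_primeFactors_le (D := 64) (by norm_num)
    (show 0 < 3 * ε by positivity)
  refine ⟨C ^ ((1 : ℝ) / 3), by positivity, fun c _ a b => ?_⟩
  have hc : (0 : ℝ) < c := Nat.cast_pos.2 (NeZero.pos c)
  have h1 := norm_kloostermanSum_pow_three_le_primeFactors c a b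
  refine le_of_pow_le_pow_left₀ (n := 3) (by norm_num) (by positivity) (h1.trans ?_)
  have cube : ∀ x : ℝ, 0 ≤ x → (x ^ ((1 : ℝ) / 3)) ^ 3 = x := fun x hx => by
    rw [← Real.rpow_natCast, ← Real.rpow_mul hx]; norm_num
  have hce : ((c : ℝ) ^ ((2 : ℝ) / 3 + ε)) ^ 3 = c ^ 2 * (c : ℝ) ^ (3 * ε) := by
    rw [← Real.rpow_natCast, ← Real.rpow_mul hc.le, ← Real.rpow_natCast (c : ℝ) 2,
      ← Real.rpow_add hc]
    congr 1; push_cast; ring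
  rw [mul_pow, mul_pow, cube _ hC.le, cube _ (Nat.cast_nonneg _), hce, Int.gcd_def,
    Int.natAbs_natCast]
  have h2 := h c (NeZero.ne c)
  calc _ ≤ C * (c : ℝ) ^ (3 * ε) * (c : ℝ) ^ 2 * (a.natAbs.gcd c : ℝ) := by gcongr
    _ = _ := by ring

end Multiplicativity

/-! ### The sums `K_{k,1}` and `K_{k,2}` as sums modulo `2k` -/

section Pairs

open Finset

theorem two_mul_dvd_kStar {k : ℕ} : 2 * k ∣ kStar k := by
  unfold kStar
  split_ifs
  · exact ⟨2, by ring⟩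
  · exact ⟨18, by ring⟩

theorem coprime_two_mul_iff {k h : ℕ} (he : Even k) : Nat.gcd h (2 * k) = 1 ↔ Nat.gcd h k = 1 :=
  ⟨fun h1 => Nat.Coprime.coprime_dvd_right (dvd_mul_left k 2) h1, fun h1 =>
    Nat.Coprime.mul_right (Nat.Coprime.coprime_dvd_right he.two_dvd h1) h1⟩

/-- The summand of `K_{k,2}(a,b)` at `h`, as a function on `ZMod (2 * k)`. -/
noncomputable def kloostermanTerm (k : ℕ) [NeZero (2 * k)] (a b : ℤ) (h : ZMod (2 * k)) : ℂ :=
  ZMod.stdAddChar (-a * h + -b * h⁻¹ : ZMod (2 * k))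

theorem kloostermanTerm_eq {k : ℕ} [NeZero (2 * k)] (a b : ℤ) {h h' : ℤ}
    (hh : h * h' ≡ -1 [ZMOD ((2 * k : ℕ) : ℤ)]) :
    kloostermanTerm k a b (h : ZMod (2 * k)) =
      Complex.exp (2 * Real.pi * Complex.I * ((-a * h + b * h' : ℤ) : ℂ) / ((2 * k : ℕ) : ℂ)) := by
  have h1 : (h : ZMod (2 * k)) * (-h' : ZMod (2 * k)) = 1 := by
    have := (ZMod.intCast_eq_intCast_iff _ _ _).2 hh
    push_cast at this
    linear_combination -this
  have h2 : (h : ZMod (2 * k))⁻¹ = -h' := ZMod.inv_eq_of_mul_eq_one _ _ _ h1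
  rw [kloostermanTerm, h2, ← ZMod.stdAddChar_coe]
  congr 1
  push_cast
  ring

theorem sum_kloostermanPairs_eq {k M : ℕ} (hk : 0 < k) (he : Even k)
    (hM : ∀ h : ℕ, Nat.gcd h M = 1 → Nat.gcd h k = 1) (F : ℕ → ℂ) :
    ∑ p ∈ kloostermanPairs k M, F p.1 = ∑ h ∈ range M with Nat.gcd h M = 1, F h := by
  refine sum_nbij Prod.fst ?_ ?_ ?_ fun _ _ => rfl
  · intro p hp
    simp only [kloostermanPairs, mem_filter, mem_product] at hp ⊢
    exact ⟨hp.1.1, hp.2.1⟩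
  · rintro ⟨h, x⟩ hp ⟨h', y⟩ hq heq
    simp only [kloostermanPairs, coe_filter, mem_product, mem_range, Set.mem_ofPred_eq] at hp hq heq
    subst heq
    rw [(existsUnique_kStar_inverse hk he (hM _ hp.2.1)).unique ⟨hp.1.2, hp.2.2⟩
      ⟨hq.1.2, hq.2.2⟩]
  · intro h hh
    simp only [coe_filter, mem_range, Set.mem_ofPred_eq] at hh
    obtain ⟨x, hx, -⟩ := existsUnique_kStar_inverse hk he (hM _ hh.2)
    refine ⟨(h, x), ?_, rfl⟩
    simp only [kloostermanPairs, coe_filter, mem_product, mem_range, Set.mem_ofPred_eq]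
    exact ⟨⟨hh.1, hx.1⟩, hh.2, hx.2⟩

theorem modEq_two_mul_of_mem_kloostermanPairs {k M : ℕ} {p : ℕ × ℕ}
    (hp : p ∈ kloostermanPairs k M) :
    (p.1 : ℤ) * (p.2 : ℤ) ≡ -1 [ZMOD ((2 * k : ℕ) : ℤ)] :=
  (mem_filter.1 hp).2.2.of_dvd (Int.natCast_dvd_natCast.2 two_mul_dvd_kStar)

theorem kloostermanK_two_eq_sum {k : ℕ} [NeZero (2 * k)] (hk : 0 < k) (he : Even k) (a b : ℤ) :
    kloostermanK k 2 a b =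
      ∑ h ∈ range (2 * k) with Nat.gcd h (2 * k) = 1, kloostermanTerm k a b (h : ZMod (2 * k)) := by
  rw [← sum_kloostermanPairs_eq hk he (fun h => (coprime_two_mul_iff he).1)
    fun h => kloostermanTerm k a b (h : ZMod (2 * k))]
  refine sum_congr rfl fun p hp => ?_
  have h := kloostermanTerm_eq a b (modEq_two_mul_of_mem_kloostermanPairs hp)
  rw [Int.cast_natCast] at h
  rw [h]
  congr 1
  push_cast
  ring

theorem kloostermanK_one_eq_sum {k : ℕ} [NeZero (2 * k)] (hk : 0 < k) (he : Even k) (n m : ℤ) :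
    kloostermanK k 1 ((n : ℚ) / 2) ((m : ℚ) / 2) =
      ∑ h ∈ range k with Nat.gcd h k = 1, kloostermanTerm k n m (h : ZMod (2 * k)) := by
  have := sum_kloostermanPairs_eq (M := k) hk he (fun h => id)
    fun h => kloostermanTerm k n m (h : ZMod (2 * k))
  rw [← this, kloostermanK, one_mul]
  refine sum_congr rfl fun p hp => ?_
  have h := kloostermanTerm_eq n m (modEq_two_mul_of_mem_kloostermanPairs hp)
  rw [Int.cast_natCast] at h
  rw [h]
  congr 1
  have : (k : ℂ) ≠ 0 := Nat.cast_ne_zero.2 hk.ne'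
  push_cast
  field_simp

/-- Since `k` and `h - x` are even, replacing `h` by `h + k` replaces the solution `h' = -x` by `h'
+ k` modulo `2k`. The phase then moves by `(m - n) / 2` full turns, an integer because both are odd.
So the sum modulo `2k` counts each residue modulo `k` twice. -/
theorem kloostermanTerm_add_self {k : ℕ} [NeZero (2 * k)] (he : Even k) {n m : ℤ}
    (hn : Odd n) (hm : Odd m) {h : ℕ} (hh : Nat.gcd h k = 1) :
    kloostermanTerm k n m ((k + h : ℕ) : ZMod (2 * k)) =
      kloostermanTerm k n m (h : ZMod (2 * k)) := by
  have hcop : IsCoprime (h : ℤ) ((2 * k : ℕ) : ℤ) :=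
    Nat.isCoprime_iff_coprime.2 ((coprime_two_mul_iff he).2 hh)
  obtain ⟨x, y, hxy⟩ := hcop
  have h1 : (h : ℤ) * (-x) ≡ -1 [ZMOD ((2 * k : ℕ) : ℤ)] :=
    (Int.modEq_iff_dvd.2 ⟨-y, by linear_combination hxy⟩)
  have hhx : Even ((h : ℤ) - x) := by
    have he' : Even (((2 * k : ℕ) : ℤ)) := ⟨k, by push_cast; ring⟩
    have hodd : Odd (x * h) := by
      have : x * h = 1 - y * ((2 * k : ℕ) : ℤ) := by linear_combination hxy
      rw [this]
      exact odd_one.sub_even (he'.mul_left y)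
    exact (Int.odd_mul.1 hodd).2.sub_odd (Int.odd_mul.1 hodd).1
  obtain ⟨r, hr⟩ := hhx
  obtain ⟨s, hs⟩ := hm.sub_odd hn
  obtain ⟨t, ht⟩ := he
  have h2 : ((k : ℤ) + h) * (-x + k) ≡ -1 [ZMOD ((2 * k : ℕ) : ℤ)] := by
    refine Int.ModEq.trans ?_ h1
    refine (Int.modEq_iff_dvd.2 ⟨-(r + t), ?_⟩)
    have ht' : (k : ℤ) = t + t := by exact_mod_cast ht
    push_cast
    linear_combination (-(k : ℤ)) * hr - k * ht'
  have e1 := kloostermanTerm_eq n m h1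
  have e2 := kloostermanTerm_eq n m h2
  push_cast at e1 e2 ⊢
  rw [e1, e2, Complex.exp_eq_exp_iff_exists_int]
  refine ⟨s, ?_⟩
  have hk : (k : ℂ) ≠ 0 := Nat.cast_ne_zero.2 (right_ne_zero_of_mul (NeZero.ne (2 * k)))
  have hs' : (m : ℂ) - n = s + s := by exact_mod_cast hs
  field_simp
  linear_combination (k : ℂ) * hs'

theorem two_mul_kloostermanK_one {k : ℕ} (hk : 0 < k) (he : Even k) {n m : ℤ}
    (hn : Odd n) (hm : Odd m) :
    2 * kloostermanK k 1 ((n : ℚ) / 2) ((m : ℚ) / 2) = kloostermanK k 2 n m := by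
  have : NeZero (2 * k) := ⟨by omega⟩
  rw [kloostermanK_one_eq_sum hk he, kloostermanK_two_eq_sum hk he]
  simp only [coprime_two_mul_iff he]
  have hrange : range (2 * k) = range (k + k) := by rw [two_mul]
  rw [sum_filter, sum_filter, hrange, sum_range_add, two_mul]
  congr 1
  refine sum_congr rfl fun h _ => ?_
  have : Nat.gcd (k + h) k = Nat.gcd h k := by simp
  simp only [this]
  split_ifs with hh
  · exact (kloostermanTerm_add_self he hn hm hh).symm
  · rfl

theorem kloostermanK_two_eq_kloostermanSum {k : ℕ} [NeZero (2 * k)] (hk : 0 < k) (he : Even k)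
    (a b : ℤ) :
    kloostermanK k 2 a b =
      kloostermanSum (ZMod.stdAddChar : AddChar (ZMod (2 * k)) ℂ) (-a : ℤ) (-b : ℤ) := by
  rw [kloostermanK_two_eq_sum hk he, kloostermanSum]
  symm
  refine sum_nbij (fun u => (u : ZMod (2 * k)).val) ?_ ?_ ?_ ?_
  · intro u _
    simp only [mem_filter, mem_range]
    exact ⟨ZMod.val_lt _, ZMod.val_coe_unit_coprime u⟩
  · intro u _ v _ h
    exact Units.ext (ZMod.val_injective _ h)
  · intro h hh
    simp only [coe_filter, mem_range, Set.mem_ofPred_eq] at hh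
    refine ⟨ZMod.unitOfCoprime h hh.2, mem_coe.2 (mem_univ _), ?_⟩
    simp only [ZMod.coe_unitOfCoprime]
    exact ZMod.val_cast_of_lt hh.1
  · intro u _
    rw [kloostermanTerm, ZMod.natCast_zmod_val, ZMod.inv_coe_unit]
    push_cast
    rfl

theorem exists_norm_kloostermanK_two_le {ε : ℝ} (hε : 0 < ε) :
    ∃ C : ℝ, 0 < C ∧ ∀ k : ℕ, 0 < k → Even k → ∀ a b : ℤ,
      ‖kloostermanK k 2 a b‖ ≤
        C * ((k : ℝ) ^ ((2 : ℝ) / 3 + ε) * (Nat.gcd a.natAbs k : ℝ) ^ ((1 : ℝ) / 3)) := by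
  obtain ⟨C, hC, h⟩ := exists_norm_kloostermanSum_le hε
  refine ⟨C * (2 ^ ((2 : ℝ) / 3 + ε) * 2 ^ ((1 : ℝ) / 3)), by positivity, fun k hk he a b => ?_⟩
  have : NeZero (2 * k) := ⟨by omega⟩
  rw [kloostermanK_two_eq_kloostermanSum hk he]
  refine (h (2 * k) (-a) (-b)).trans ?_
  rw [Int.natAbs_neg]
  have hg : Nat.gcd a.natAbs (2 * k) ≤ 2 * Nat.gcd a.natAbs k :=
    Nat.le_of_dvd (by have := Nat.gcd_pos_of_pos_right a.natAbs hk; omega)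
      ((Nat.gcd_mul_right_dvd_mul_gcd _ _ _).trans (mul_dvd_mul_right (Nat.gcd_dvd_right _ _) _))
  have hg' : ((Nat.gcd a.natAbs (2 * k) : ℕ) : ℝ) ≤ 2 * (Nat.gcd a.natAbs k : ℕ) := by
    exact_mod_cast hg
  calc _ ≤ C * ((2 * k : ℝ) ^ ((2 : ℝ) / 3 + ε) *
        (2 * (Nat.gcd a.natAbs k : ℕ) : ℝ) ^ ((1 : ℝ) / 3)) := by
        push_cast
        gcongr
    _ = _ := by
        rw [Real.mul_rpow (by norm_num) (Nat.cast_nonneg _),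
          Real.mul_rpow (by norm_num) (Nat.cast_nonneg _)]
        ring

theorem exists_norm_kloostermanK_one_le {ε : ℝ} (hε : 0 < ε) :
    ∃ C : ℝ, 0 < C ∧ ∀ k : ℕ, 0 < k → Even k → ∀ n m : ℤ, Odd n → Odd m →
      ‖kloostermanK k 1 ((n : ℚ) / 2) ((m : ℚ) / 2)‖ ≤
        C * ((k : ℝ) ^ ((2 : ℝ) / 3 + ε) * (Nat.gcd n.natAbs k : ℝ) ^ ((1 : ℝ) / 3)) := by
  obtain ⟨C, hC, h⟩ := exists_norm_kloostermanK_two_le hε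
  refine ⟨C, hC, fun k hk he n m hn hm => le_trans ?_ (h k hk he n m)⟩
  rw [← two_mul_kloostermanK_one hk he hn hm, norm_mul, Complex.norm_ofNat]
  linarith [norm_nonneg (kloostermanK k 1 ((n : ℚ) / 2) ((m : ℚ) / 2))]

end Pairs

/-! ### The Farey condition and completion of the incomplete sum -/

section Incomplete

open Finset

theorem fareyPred_eq {N h k h₁ k₁ : ℕ} (hh : 0 < h) (hhk : h < k) (hN : k ≤ N) (hk1 : k₁ ≤ N)
    (hlt : N < k + k₁) (hdet : h * k₁ = k * h₁ + 1) :
    fareyPred N ((h : ℚ) / k) = (h₁ : ℚ) / k₁ := by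
  have hk : 0 < k := by omega
  have hk1pos : 0 < k₁ := by omega
  have hkQ : (0 : ℚ) < k := by exact_mod_cast hk
  have hk1Q : (0 : ℚ) < k₁ := by exact_mod_cast hk1pos
  have hle : h₁ ≤ k₁ := by
    by_contra hc
    push Not at hc
    nlinarith
  have hgcd : Nat.gcd h₁ k₁ = 1 := by
    rw [← Nat.coprime_iff_gcd_eq_one, ← Nat.isCoprime_iff_coprime]
    exact ⟨-k, h, by have : (h : ℤ) * k₁ = k * h₁ + 1 := by exact_mod_cast hdet
                     linear_combination this⟩
  obtain ⟨hmem, hltp, hmax⟩ := fareyPred_spec hh hk hN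
  have hmem1 : (h₁ : ℚ) / k₁ ∈ farey N := by
    refine mem_image.2 ⟨(h₁, k₁), ?_, rfl⟩
    simp only [mem_filter, mem_product, mem_range]
    exact ⟨⟨by omega, by omega⟩, by omega, hle, hgcd⟩
  have hlt1 : (h₁ : ℚ) / k₁ < h / k := by
    rw [div_lt_div_iff₀ hk1Q hkQ]
    have : h₁ * k < h * k₁ := by rw [hdet, mul_comm]; omega
    exact_mod_cast this
  refine le_antisymm ?_ (hmax _ hmem1 hlt1)
  by_contra hc
  push Not at hc
  obtain ⟨⟨a, b⟩, hab, he⟩ := mem_image.1 hmem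
  simp only [mem_filter, mem_product, mem_range] at hab
  simp only at he
  rw [← he] at hc hltp
  have hbQ : (0 : ℚ) < b := by exact_mod_cast hab.2.1
  rw [div_lt_div_iff₀ hk1Q hbQ] at hc
  rw [div_lt_div_iff₀ hbQ hkQ] at hltp
  have c1 : (h₁ : ℤ) * b + 1 ≤ a * k₁ := by exact_mod_cast hc
  have c2 : (a : ℤ) * k + 1 ≤ h * b := by exact_mod_cast hltp
  have c3 : (h : ℤ) * k₁ = k * h₁ + 1 := by exact_mod_cast hdet
  -- A fraction `a / b` strictly between the two neighbours has both brackets at least `1`, hence `b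
  -- ≥ k + k₁ > N`.
  have c4 : (b : ℤ) = k₁ * (h * b - a * k) + k * (a * k₁ - h₁ * b) := by
    linear_combination (-(b : ℤ)) * c3
  have c5 : (k₁ : ℤ) * 1 ≤ k₁ * (h * b - a * k) := by gcongr; linarith
  have c6 : (k : ℤ) * 1 ≤ k * (a * k₁ - h₁ * b) := by gcongr; linarith
  have c7 : (b : ℤ) ≤ N := by exact_mod_cast Nat.lt_succ_iff.1 hab.1.2
  have c8 : (N : ℤ) < k + k₁ := by exact_mod_cast hlt
  linarith

theorem fareyPredDen_spec {N h k : ℕ} (hh : 0 < h) (hhk : h < k) (hN : k ≤ N)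
    (hc : Nat.gcd h k = 1) :
    fareyPredDen N h k ≤ N ∧ N < k + fareyPredDen N h k ∧
      (h : ℤ) * fareyPredDen N h k ≡ 1 [ZMOD k] := by
  obtain ⟨x, y, hxy⟩ := Nat.isCoprime_iff_coprime.2 hc
  have hkZ : (0 : ℤ) < k := by exact_mod_cast (by omega : 0 < k)
  have hhZ : (0 : ℤ) < h := by exact_mod_cast hh
  have hNZ : (k : ℤ) ≤ N := by exact_mod_cast hN
  -- The denominator sought is the representative in `(N - k, N]` of the inverse `x` of `h` modulo
  -- `k`, namely `N - r` with `r = (N - x) mod k`.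
  have b1 := Int.emod_nonneg ((N : ℤ) - x) hkZ.ne'
  have b2 := Int.emod_lt_of_pos ((N : ℤ) - x) hkZ
  have b3 := Int.emod_add_mul_ediv ((N : ℤ) - x) k
  set r := ((N : ℤ) - x) % k
  set e := ((N : ℤ) - x) / k
  obtain ⟨k₁, hk1⟩ := Int.eq_ofNat_of_zero_le (show 0 ≤ (N : ℤ) - r by linarith)
  have hdet : (h : ℤ) * k₁ = k * (h * e - y) + 1 := by
    rw [← hk1]
    linear_combination hxy - h * b3
  have hk1pos : (0 : ℤ) < k₁ := by rw [← hk1]; linarith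
  have hnn : 0 ≤ h * e - y := by
    by_contra hneg
    push Not at hneg
    nlinarith [mul_pos hhZ hk1pos]
  obtain ⟨h₁, hh1⟩ := Int.eq_ofNat_of_zero_le hnn
  rw [hh1] at hdet
  have hdet' : h * k₁ = k * h₁ + 1 := by exact_mod_cast hdet
  have hk1N : k₁ ≤ N := by
    have : (k₁ : ℤ) ≤ N := by rw [← hk1]; linarith
    exact_mod_cast this
  have hlt : N < k + k₁ := by
    have : (N : ℤ) < k + k₁ := by rw [← hk1]; linarith
    exact_mod_cast this
  have hden : fareyPredDen N h k = k₁ := by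
    rw [fareyPredDen, fareyPred_eq hh hhk hN hk1N hlt hdet']
    have hcop : Nat.Coprime h₁ k₁ := by
      rw [← Nat.isCoprime_iff_coprime]
      exact ⟨-k, h, by linear_combination hdet⟩
    have := Rat.den_div_eq_of_coprime (a := (h₁ : ℤ)) (b := (k₁ : ℤ)) hk1pos (by simpa using hcop)
    push_cast at this
    exact_mod_cast this
  rw [hden]
  refine ⟨hk1N, hlt, ?_⟩
  rw [hdet]
  exact Int.modEq_iff_dvd.2 ⟨-h₁, by ring⟩

/-- The Farey condition selects the `h` whose inverse lies in an interval modulo `k`. -/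
theorem fareyPredDen_le_iff {N h k l : ℕ} (hh : 0 < h) (hhk : h < k) (hN : k ≤ N)
    (hc : Nat.gcd h k = 1) (hl1 : N + 1 ≤ l) (hl2 : l ≤ N + k - 1) {h' : ℕ}
    (hinv : (h : ℤ) * h' ≡ -1 [ZMOD k]) :
    (N < k + fareyPredDen N h k ∧ k + fareyPredDen N h k ≤ l) ↔
      ∃ i < l - N, (((N + 1 - k + i + h' : ℕ)) : ZMod k) = 0 := by
  obtain ⟨s1, s2, s3⟩ := fareyPredDen_spec hh hhk hN hc
  set d := fareyPredDen N h k
  have key : ∀ v : ℕ, ((v + h' : ℕ) : ZMod k) = 0 ↔ (v : ZMod k) = d := by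
    intro v
    have e1 := (ZMod.intCast_eq_intCast_iff _ _ _).2 hinv
    have e2 := (ZMod.intCast_eq_intCast_iff _ _ _).2 s3
    push_cast at e1 e2 ⊢
    have hd : (d : ZMod k) + h' = 0 := by linear_combination d * e1 - h' * e2
    constructor
    · intro h; linear_combination h - hd
    · intro h; linear_combination h + hd
  constructor
  · rintro ⟨-, h2⟩
    refine ⟨k + d - (N + 1), by omega, ?_⟩
    rw [key]
    congr 1
    omega
  · rintro ⟨i, hi, h⟩
    rw [key, ZMod.natCast_eq_natCast_iff] at h
    have : N + 1 - k + i = d := by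
      -- Both sides lie in `(N - k, N]`, a complete residue system modulo `k`, so congruence forces
      -- equality.
      refine Nat.ModEq.eq_of_abs_lt h ?_
      rw [abs_lt]
      omega
    omega

/-- The denominator is `2 |sin (π j / k)|`, and Jordan's inequality applies to the smaller of `j`
and `k - j`. Adding both reciprocals avoids the minimum. -/
theorem two_div_norm_exp_sub_one_le {j k : ℕ} (hj : 0 < j) (hjk : j < k) :
    2 / ‖Complex.exp (2 * Real.pi * Complex.I * j / k) - 1‖ ≤
      k / 2 * (1 / (j : ℝ) + 1 / ((k - j : ℕ) : ℝ)) := by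
  have hjR : (0 : ℝ) < j := by exact_mod_cast hj
  have hkR : (0 : ℝ) < k := by exact_mod_cast (by omega : 0 < k)
  have hkj : ((k - j : ℕ) : ℝ) = k - j := by push_cast [hjk.le]; ring
  have hkjR : (0 : ℝ) < (k : ℝ) - j := by rw [sub_pos]; exact_mod_cast hjk
  have hnorm : ‖Complex.exp (2 * Real.pi * Complex.I * j / k) - 1‖ =
      2 * |Real.sin (Real.pi * j / k)| := by
    have : (2 * Real.pi * Complex.I * j / k : ℂ) =
        Complex.I * ((2 * Real.pi * j / k : ℝ) : ℂ) := by push_cast; ring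
    rw [this, Complex.norm_exp_I_mul_ofReal_sub_one, norm_mul, Real.norm_ofNat, Real.norm_eq_abs]
    congr 3; ring
  have hpi := Real.pi_pos
  have hsin : ∀ t : ℝ, 0 < t → t ≤ k / 2 → 2 * t / k ≤ Real.sin (Real.pi * t / k) := by
    intro t ht htk
    have := Real.mul_le_sin (x := Real.pi * t / k) (by positivity)
      (by rw [div_le_div_iff₀ hkR two_pos]; nlinarith)
    convert this using 1
    field_simp
  have main : ∀ t : ℝ, 0 < t → 2 * t / k ≤ Real.sin (Real.pi * j / k) →
      2 / ‖Complex.exp (2 * Real.pi * Complex.I * j / k) - 1‖ ≤ k / 2 * (1 / t) := by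
    intro t ht h
    rw [hnorm]
    calc 2 / (2 * |Real.sin (Real.pi * j / k)|) ≤ 2 / (2 * (2 * t / k)) := by
          gcongr
          exact h.trans (le_abs_self _)
      _ = _ := by field_simp
  rcases le_total (j : ℝ) (k / 2) with h | h
  · refine (main j hjR (hsin j hjR h)).trans ?_
    gcongr
    rw [hkj]
    have := one_div_pos.2 hkjR
    linarith
  · have := hsin (k - j) hkjR (by linarith)
    have e : Real.pi * ((k : ℝ) - j) / k = Real.pi - Real.pi * j / k := by field_simp
    rw [e, Real.sin_pi_sub] at this
    refine (main _ hkjR this).trans ?_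
    gcongr
    rw [hkj]
    have := one_div_pos.2 hjR
    linarith

/-- The Fourier coefficients modulo `k` of the interval `v, …, v + L - 1`. -/
noncomputable def intervalCoeff (k v L : ℕ) [NeZero k] (j : ZMod k) : ℂ :=
  (1 / k) * ∑ i ∈ range L, ZMod.stdAddChar (j * ((v + i : ℕ) : ZMod k))

theorem sum_intervalCoeff_mul {k v L : ℕ} [NeZero k] (hL : L ≤ k) (x : ℕ) :
    ∑ j : ZMod k, intervalCoeff k v L j * ZMod.stdAddChar (j * (x : ZMod k)) =
      if ∃ i < L, ((v + i + x : ℕ) : ZMod k) = 0 then 1 else 0 := by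
  have hk : (k : ℂ) ≠ 0 := Nat.cast_ne_zero.2 (NeZero.ne k)
  have h1 : ∑ j : ZMod k, intervalCoeff k v L j * ZMod.stdAddChar (j * (x : ZMod k)) =
      ∑ i ∈ range L, if ((v + i + x : ℕ) : ZMod k) = 0 then (1 : ℂ) else 0 := by
    simp only [intervalCoeff, mul_assoc, sum_mul]
    rw [← mul_sum, sum_comm, mul_sum]
    refine sum_congr rfl fun i _ => ?_
    simp only [← AddChar.map_add_eq_mul, ← mul_add, ← Nat.cast_add]
    rw [AddChar.sum_mulShift _ (ZMod.isPrimitive_stdAddChar k), ZMod.card]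
    split_ifs
    · field_simp
    · simp
  rw [h1, sum_boole]
  split_ifs with h
  · obtain ⟨i, hi, h0⟩ := h
    have : {i ∈ range L | ((v + i + x : ℕ) : ZMod k) = 0} = {i} := by
      ext i'
      simp only [mem_filter, mem_range, mem_singleton]
      refine ⟨fun ⟨hi', h'⟩ => ?_, fun h => h ▸ ⟨hi, h0⟩⟩
      have heq : ((i' : ℕ) : ZMod k) = i := by
        push_cast at h0 h'
        linear_combination h' - h0
      rw [ZMod.natCast_eq_natCast_iff'] at heq
      rwa [Nat.mod_eq_of_lt (by omega), Nat.mod_eq_of_lt (by omega)] at heq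
    rw [this]; simp
  · rw [Nat.cast_eq_zero, card_eq_zero, filter_eq_empty_iff]
    intro i hi h0
    exact h ⟨i, mem_range.1 hi, h0⟩

theorem norm_intervalCoeff_zero_le {k v L : ℕ} [NeZero k] (hL : L ≤ k) :
    ‖intervalCoeff k v L 0‖ ≤ 1 := by
  have hk : (0 : ℝ) < k := Nat.cast_pos.2 (NeZero.pos k)
  simp only [intervalCoeff, zero_mul, AddChar.map_zero_eq_one, sum_const, card_range, nsmul_eq_mul,
    mul_one, norm_mul, norm_div, norm_one, Complex.norm_natCast]
  rw [one_div, inv_mul_le_iff₀ hk, mul_one]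
  exact_mod_cast hL

theorem norm_intervalCoeff_le {k v L j : ℕ} [NeZero k] (hj : 0 < j) (hjk : j < k) :
    ‖intervalCoeff k v L (j : ZMod k)‖ ≤ 1 / 2 * (1 / (j : ℝ) + 1 / ((k - j : ℕ) : ℝ)) := by
  have hk : (0 : ℝ) < k := Nat.cast_pos.2 (NeZero.pos k)
  set ζ : ℂ := ZMod.stdAddChar (j : ZMod k) with hζ
  have hζ' : ζ = Complex.exp (2 * Real.pi * Complex.I * j / k) := by
    have := ZMod.stdAddChar_coe (N := k) (j : ℤ)
    push_cast at this
    rw [hζ, this]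
  have hne : ζ ≠ 1 := by
    intro h
    rw [hζ, (ZMod.isPrimitive_stdAddChar k).zmod_char_eq_one_iff, ZMod.natCast_eq_zero_iff] at h
    exact absurd (Nat.le_of_dvd hj h) (by omega)
  have hn1 : ‖ζ‖ = 1 := by rw [hζ, AddChar.norm_apply]
  have hsum : ∑ i ∈ range L, ZMod.stdAddChar ((j : ZMod k) * ((v + i : ℕ) : ZMod k)) =
      ζ ^ v * ((ζ ^ L - 1) / (ζ - 1)) := by
    rw [← geom_sum_eq hne, mul_sum]
    refine sum_congr rfl fun i _ => ?_
    rw [hζ, ← pow_add, ← AddChar.map_nsmul_eq_pow, nsmul_eq_mul, mul_comm]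
  have hnum : ‖ζ ^ L - 1‖ ≤ 2 := by
    refine (norm_sub_le _ _).trans ?_
    rw [norm_pow, hn1, one_pow, norm_one]; norm_num
  rw [intervalCoeff, hsum, norm_mul, norm_mul, norm_pow, hn1, one_pow, one_mul, norm_div, norm_div,
    norm_one, Complex.norm_natCast]
  calc 1 / (k : ℝ) * (‖ζ ^ L - 1‖ / ‖ζ - 1‖) ≤ 1 / (k : ℝ) * (2 / ‖ζ - 1‖) := by gcongr
    _ ≤ 1 / (k : ℝ) * (k / 2 * (1 / (j : ℝ) + 1 / ((k - j : ℕ) : ℝ))) := by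
        rw [hζ']
        gcongr
        exact two_div_norm_exp_sub_one_le hj hjk
    _ = _ := by field_simp

/-- The zero frequency contributes at most `1`. For the others, the reflection `j ↦ k - j`
identifies the two halves of the bound, leaving one harmonic sum. -/
theorem sum_norm_intervalCoeff_le {k v L : ℕ} [NeZero k] (hL : L ≤ k) :
    ∑ j : ZMod k, ‖intervalCoeff k v L j‖ ≤ 2 + Real.log k := by
  obtain ⟨n, rfl⟩ := Nat.exists_eq_succ_of_ne_zero (NeZero.ne k)
  have h1 : ∑ j : ZMod (n + 1), ‖intervalCoeff (n + 1) v L j‖ =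
      ∑ i ∈ range (n + 1), ‖intervalCoeff (n + 1) v L (i : ZMod (n + 1))‖ := by
    symm
    refine sum_nbij' (fun i => (i : ZMod (n + 1))) ZMod.val (fun _ _ => mem_univ _)
      (fun j _ => mem_range.2 (ZMod.val_lt j)) (fun i hi => ZMod.val_cast_of_lt (mem_range.1 hi))
      (fun j _ => ZMod.natCast_zmod_val j) fun _ _ => rfl
  have h2 : ∑ i ∈ range n, ‖intervalCoeff (n + 1) v L ((i + 1 : ℕ) : ZMod (n + 1))‖ ≤
      ∑ i ∈ range n, 1 / ((i + 1 : ℕ) : ℝ) := by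
    calc _ ≤ ∑ i ∈ range n, (1 / 2 * (1 / ((i + 1 : ℕ) : ℝ)) +
          1 / 2 * (1 / ((n - 1 - i + 1 : ℕ) : ℝ))) := by
          refine sum_le_sum fun i hi => ?_
          have hi' := mem_range.1 hi
          refine (norm_intervalCoeff_le (Nat.succ_pos i) (by omega)).trans_eq ?_
          rw [mul_add]
          congr 5
          omega
      _ = _ := by
          rw [sum_add_distrib, sum_range_reflect (fun i => 1 / 2 * (1 / ((i + 1 : ℕ) : ℝ))) n,
            ← mul_sum]
          ring
  have h3 : ∑ i ∈ range n, 1 / ((i + 1 : ℕ) : ℝ) ≤ 1 + Real.log ((n + 1 : ℕ) : ℝ) := by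
    rcases Nat.eq_zero_or_pos n with rfl | hn
    · simp
    have := harmonic_le_one_add_log n
    simp only [harmonic] at this
    push_cast at this ⊢
    simp only [one_div]
    refine this.trans ?_
    gcongr
    linarith
  rw [h1, sum_range_succ', Nat.cast_zero]
  have h0 := norm_intervalCoeff_zero_le (v := v) hL
  linarith

/-- The frequency `j` contributes the factor `exp (2πi j h' / k)`, which amounts to replacing `m /
2` by `(m + 2 j) / 2`. The shifted numerator stays odd, so the bound for `K_{k,1}` still applies. -/
theorem incompleteK_eq_sum {N k l : ℕ} [NeZero k] (hN : k ≤ N) (he : Even k) (n m : ℤ)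
    (hl1 : N + 1 ≤ l) (hl2 : l ≤ N + k - 1) :
    incompleteK N k l ((n : ℚ) / 2) ((m : ℚ) / 2) =
      ∑ j : ZMod k, intervalCoeff k (N + 1 - k) (l - N) j *
        kloostermanK k 1 ((n : ℚ) / 2) (((m + 2 * j.val : ℤ) : ℚ) / 2) := by
  have hk := NeZero.pos k
  have hkC : (k : ℂ) ≠ 0 := Nat.cast_ne_zero.2 hk.ne'
  simp only [kloostermanK, mul_sum]
  rw [sum_comm, incompleteK, sum_filter, one_mul]
  refine sum_congr rfl fun p hp => ?_
  obtain ⟨h1, h2, h3⟩ := mem_filter.1 hp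
  rw [mem_product, mem_range] at h1
  -- For `h = 0` coprimality would force `k = 1`, which is odd; thus every fraction in the sum has a
  -- predecessor.
  have hpos : 0 < p.1 := by
    refine Nat.pos_of_ne_zero fun h0 => ?_
    rw [h0, Nat.gcd_zero_left] at h2
    rw [h2] at he
    exact absurd he (by decide)
  have hinv : (p.1 : ℤ) * p.2 ≡ -1 [ZMOD k] :=
    (modEq_two_mul_of_mem_kloostermanPairs hp).of_dvd (by push_cast; exact dvd_mul_left _ _)
  have hiff := fareyPredDen_le_iff hpos h1.1 hN h2 hl1 hl2 hinv
  have hterm : ∀ j : ZMod k,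
      Complex.exp (2 * Real.pi * Complex.I / (((1 : ℕ) : ℂ) * k) *
        (-(((n : ℚ) / 2 : ℚ) : ℂ) * p.1 + ((((m + 2 * j.val : ℤ) : ℚ) / 2 : ℚ) : ℂ) * p.2)) =
      ZMod.stdAddChar (j * (p.2 : ZMod k)) * Complex.exp (2 * Real.pi * Complex.I / k *
        (-(((n : ℚ) / 2 : ℚ) : ℂ) * p.1 + (((m : ℚ) / 2 : ℚ) : ℂ) * p.2)) := by
    intro j
    have hj := ZMod.stdAddChar_coe (N := k) ((j.val * p.2 : ℕ) : ℤ)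
    push_cast at hj
    rw [ZMod.natCast_zmod_val] at hj
    rw [hj, ← Complex.exp_add]
    congr 1
    push_cast
    field_simp
    ring
  simp only [hterm]
  rw [sum_congr rfl fun j _ => (mul_assoc _ _ _).symm, ← sum_mul,
    sum_intervalCoeff_mul (by omega)]
  simp only [hiff]
  split_ifs <;> simp

theorem exists_norm_incompleteK_le {ε : ℝ} (hε : 0 < ε) :
    ∃ C : ℝ, 0 < C ∧ ∀ N k : ℕ, 0 < k → k ≤ N → Even k → ∀ n m : ℤ, Odd n → Odd m →
      ∀ l : ℕ, N + 1 ≤ l → l ≤ N + k - 1 →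
        ‖incompleteK N k l ((n : ℚ) / 2) ((m : ℚ) / 2)‖ ≤
          C * ((k : ℝ) ^ ((2 : ℝ) / 3 + ε) * (Nat.gcd n.natAbs k : ℝ) ^ ((1 : ℝ) / 3)) := by
  -- Half of `ε` is kept to absorb `2 + log k`. The bound for `K_{k,1}` involves only `n`, so it is
  -- uniform over the shifts of `m`.
  obtain ⟨C, hC, h⟩ := exists_norm_kloostermanK_one_le (half_pos hε)
  refine ⟨(2 + 1 / (ε / 2)) * C, by positivity, fun N k hk hN he n m hn hm l hl1 hl2 => ?_⟩
  have : NeZero k := ⟨hk.ne'⟩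
  have hkR : (1 : ℝ) ≤ k := by exact_mod_cast hk
  rw [incompleteK_eq_sum hN he n m hl1 hl2]
  set B := C * ((k : ℝ) ^ ((2 : ℝ) / 3 + ε / 2) * (Nat.gcd n.natAbs k : ℝ) ^ ((1 : ℝ) / 3)) with hB
  have hlog : 2 + Real.log k ≤ (2 + 1 / (ε / 2)) * (k : ℝ) ^ (ε / 2) := by
    have e1 := Real.log_le_rpow_div (Nat.cast_nonneg k) (half_pos hε)
    have e2 := Real.one_le_rpow hkR (half_pos hε).le
    rw [add_mul, one_div_mul_eq_div]
    linarith
  calc _ ≤ ∑ j : ZMod k, ‖intervalCoeff k (N + 1 - k) (l - N) j‖ * B := by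
        refine (norm_sum_le _ _).trans (sum_le_sum fun j _ => ?_)
        rw [norm_mul]
        gcongr
        exact h k hk he n _ hn (hm.add_even (even_two_mul _))
    _ ≤ (2 + Real.log k) * B := by
        rw [← sum_mul]
        gcongr
        exact sum_norm_intervalCoeff_le (by omega)
    _ ≤ (2 + 1 / (ε / 2)) * (k : ℝ) ^ (ε / 2) * B := by gcongr
    _ = _ := by
        have : (k : ℝ) ^ ((2 : ℝ) / 3 + ε) = k ^ (ε / 2) * (k : ℝ) ^ ((2 : ℝ) / 3 + ε / 2) := by
          rw [← Real.rpow_add (by linarith)]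
          congr 1; ring
        rw [hB, this]
        ring

end Incomplete

theorem mainTheorem3 (ε : ℝ) (hε : 0 < ε) :
    ∃ C : ℝ, 0 < C ∧
      ∀ N k : ℕ, 0 < k → k ≤ N → Even k →
        (∀ a b : ℤ,
          ‖kloostermanK k 2 (a : ℚ) (b : ℚ)‖ ≤
            C * ((k : ℝ) ^ ((2 : ℝ) / 3 + ε) * (Nat.gcd a.natAbs k : ℝ) ^ ((1 : ℝ) / 3))) ∧
        (∀ n m : ℤ, Odd n → Odd m →
          ‖kloostermanK k 1 ((n : ℚ) / 2) ((m : ℚ) / 2)‖ ≤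
            C * ((k : ℝ) ^ ((2 : ℝ) / 3 + ε) * (Nat.gcd n.natAbs k : ℝ) ^ ((1 : ℝ) / 3))) ∧
        (∀ n m : ℤ, Odd n → Odd m → ∀ l : ℕ, N + 1 ≤ l → l ≤ N + k - 1 →
          ‖incompleteK N k l ((n : ℚ) / 2) ((m : ℚ) / 2)‖ ≤
            C * ((k : ℝ) ^ ((2 : ℝ) / 3 + ε) * (Nat.gcd n.natAbs k : ℝ) ^ ((1 : ℝ) / 3))) := by
  obtain ⟨C₁, hC₁, h₁⟩ := exists_norm_kloostermanK_two_le hε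
  obtain ⟨C₂, hC₂, h₂⟩ := exists_norm_kloostermanK_one_le hε
  obtain ⟨C₃, hC₃, h₃⟩ := exists_norm_incompleteK_le hε
  refine ⟨C₁ + C₂ + C₃, by positivity, fun N k hk hN he => ⟨fun a b => ?_, fun n m hn hm => ?_,
    fun n m hn hm l hl1 hl2 => ?_⟩⟩
  · refine (h₁ k hk he a b).trans (mul_le_mul_of_nonneg_right ?_ (by positivity))
    linarith
  · refine (h₂ k hk he n m hn hm).trans (mul_le_mul_of_nonneg_right ?_ (by positivity))
    linarith
  · refine (h₃ N k hk hN he n m hn hm l hl1 hl2).trans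
      (mul_le_mul_of_nonneg_right ?_ (by positivity))
    linarith
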